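/- Let $X$ and $Y$ be Polish spaces, let $d_Y$ be a metric that induces the topology of $Y$, and let $t\in[1,\infty)$. Let $\mathcal P(X)$ be the set of Borel probability measures on $X$, and let $\mathcal P^t_{d_Y}(Y)$ be the set of Borel probability measures $p$ on $Y$ with $\int d_Y(y,y_0)^t\,p(dy)<\infty$ for some (equivalently, any) $y_0\in Y$, equipped with the topology of the Wasserstein metric $$\mathcal W_t(p,q)=\Big(\inf_{\pi\in\Pi(p,q)}\int d_Y(y,y')^t\,\pi(dy,dy')\Big)^{1/t},$$ where $\Pi(\cdot,\cdot)$ denotes the set of couplings of two probability measures. Let $C\colon X\times\mathcal P^t_{d_Y}(Y)\to\mathbb R\cup\{+\infty\}$ be lower semicontinuous with respect to the product topology, bounded from below, and convex in its second argument, i.e. $C(x,\alpha p+(1-\alpha)q)\le\alpha C(x,p)+(1-\alpha)C(x,q)$ for all $x\in X$, $p,q\in\mathcal P^t_{d_Y}(Y)$, $\alpha\in[0,1]$. For $\mu\in\mathcal P(X)$ and $\nu\in\mathcal P^t_{d_Y}(Y)$ put $$V(\mu,\nu)=\inf_{\pi\in\Pi(\mu,\nu)}\int_X C(x,\pi_x)\,\mu(dx),$$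 where $(\pi_x)_{x\in X}$ is a regular disintegration of $\pi$ with respect to its first marginal $\mu$ (so that $\pi_x\in\mathcal P^t_{d_Y}(Y)$ for $\mu$-a.e. $x$). Let $\Phi_{b,t}$ be the set of continuous functions $\psi\colon Y\to\mathbb R$ for which there are $a,b,\ell\in\mathbb R$ and $y_0\in Y$ with $\ell\le\psi(y)\le a+b\,d_Y(y_0,y)^t$ for all $y\in Y$, and for $\psi\in\Phi_{b,t}$ put $$R_C\psi(x)=\inf_{p\in\mathcal P^t_{d_Y}(Y)}\Big(\int\psi\,dp+C(x,p)\Big),\qquad x\in X.$$ Then, for all $\mu\in\mathcal P(X)$ and $\nu\in\mathcal P^t_{d_Y}(Y)$, in $\mathbb R\cup\{+\infty\}$, $$V(\mu,\nu)=\sup_{\psi\in\Phi_{b,t}}\Big(\int_X R_C\psi\,d\mu-\int_Y\psi\,d\nu\Big).$$ -/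

import Mathlib

open MeasureTheory Topology
open scoped ENNReal

noncomputable section

namespace WeakTransport

/-- The set `Π(μ, ν)` of couplings of `μ` and `ν`. -/
def couplings {X Y : Type*} [MeasurableSpace X] [MeasurableSpace Y]
    (μ : ProbabilityMeasure X) (ν : ProbabilityMeasure Y) : Set (ProbabilityMeasure (X × Y)) :=
  {π | (π : Measure (X × Y)).fst = (μ : Measure X) ∧ (π : Measure (X × Y)).snd = (ν : Measure Y)}

/-- The space `𝒫ᵗ(Y)` of Borel probability measures on `Y` with finite `t`-th moment. This is a
structure rather than a subtype, so that it does not inherit the weak topology. -/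
@[ext]
structure PSpace (Y : Type*) [MetricSpace Y] [MeasurableSpace Y] (t : ℝ) where
  /-- the underlying probability measure -/
  toProb : ProbabilityMeasure Y
  finite_moment : ∃ y₀ : Y, ∫⁻ y, edist y y₀ ^ t ∂(toProb : Measure Y) < ∞

section Wasserstein

variable {Y : Type*} [MetricSpace Y] [MeasurableSpace Y] {t : ℝ}

/-- The underlying measure of an element of `𝒫ᵗ(Y)`. -/
def PSpace.toMeasure (p : PSpace Y t) : Measure Y := (p.toProb : Measure Y)

/-- The `t`-Wasserstein distance
`𝒲ₜ(p, q) = (inf_{π ∈ Π(p, q)} ∫ d(y, y')ᵗ π(dy, dy'))^{1/t}`. -/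
def wasserstein (p q : PSpace Y t) : ℝ≥0∞ :=
  (⨅ π ∈ couplings p.toProb q.toProb,
    ∫⁻ z, edist z.1 z.2 ^ t ∂(π : Measure (Y × Y))) ^ (1 / t)

/-- The topology of `𝒲ₜ` on `𝒫ᵗ(Y)`: a set is open if and only if it contains a `𝒲ₜ`-ball of
positive radius around each of its points. -/
instance PSpace.instTopologicalSpace : TopologicalSpace (PSpace Y t) where
  IsOpen U := ∀ p ∈ U, ∃ ε : ℝ≥0∞, 0 < ε ∧ ∀ q, wasserstein p q < ε → q ∈ U
  isOpen_univ := fun _ _ => ⟨1, one_pos, fun _ _ => Set.mem_univ _⟩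
  isOpen_inter := by
    rintro U V hU hV p ⟨hpU, hpV⟩
    obtain ⟨ε, hε, h⟩ := hU p hpU
    obtain ⟨δ, hδ, h'⟩ := hV p hpV
    exact ⟨min ε δ, lt_min hε hδ, fun q hq =>
      ⟨h q (hq.trans_le (min_le_left _ _)), h' q (hq.trans_le (min_le_right _ _))⟩⟩
  isOpen_sUnion := by
    rintro S hS p ⟨U, hU, hpU⟩
    obtain ⟨ε, hε, h⟩ := hS U hU p hpU
    exact ⟨ε, hε, fun q hq => ⟨U, hU, h q hq⟩⟩

/-- Convexity on `𝒫ᵗ(Y)`: `F(α p + (1 - α) q) ≤ α F(p) + (1 - α) F(q)` for `α ∈ [0, 1]`. Here `r`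
is the mixture `α p + (1 - α) q`, which again belongs to `𝒫ᵗ(Y)`. -/
def ConvexOnPSpace (F : PSpace Y t → EReal) : Prop :=
  ∀ (p q r : PSpace Y t) (α : ℝ), 0 ≤ α → α ≤ 1 →
    r.toMeasure = ENNReal.ofReal α • p.toMeasure + ENNReal.ofReal (1 - α) • q.toMeasure →
    F r ≤ (α : EReal) * F p + ((1 - α : ℝ) : EReal) * F q

/-- The class `Φ_{b,t}` of continuous functions `ψ` with `ℓ ≤ ψ ≤ a + b d(y₀, ·)ᵗ` for some
`a, b, ℓ ∈ ℝ` and `y₀ ∈ Y`. -/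
def Phi (Y : Type*) [MetricSpace Y] (t : ℝ) : Set (Y → ℝ) :=
  {ψ | Continuous ψ ∧ ∃ (a b ℓ : ℝ) (y₀ : Y), ∀ y, ℓ ≤ ψ y ∧ ψ y ≤ a + b * dist y₀ y ^ t}

end Wasserstein

/-- The integral of an extended-real-valued function: the integral of the positive part minus
the integral of the negative part. It is used only for (a.e.) bounded below functions, for which
the second term is finite. -/
def eintegral {X : Type*} [MeasurableSpace X] (μ : Measure X) (f : X → EReal) : EReal :=
  ((∫⁻ x, (f x).toENNReal ∂μ : ℝ≥0∞) : EReal) - ((∫⁻ x, (-f x).toENNReal ∂μ : ℝ≥0∞) : EReal)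

section Transport

variable {X Y : Type*} [MeasurableSpace X] [MetricSpace Y] [MeasurableSpace Y] {t : ℝ}

open Classical in
/-- The cost `C(x, ·)` evaluated at an arbitrary measure `p`; its value is irrelevant (here `+∞`)
when `p` is not in `𝒫ᵗ(Y)`. If `π ∈ Π(μ, ν)` with `ν ∈ 𝒫ᵗ(Y)`, then `π_x ∈ 𝒫ᵗ(Y)` for
`μ`-almost every `x`. -/
def costAt (C : X → PSpace Y t → EReal) (x : X) (p : Measure Y) : EReal :=
  if h : ∃ q : PSpace Y t, q.toMeasure = p then C x h.choose else ⊤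

/-- The weak transport value `V(μ, ν) = inf_{π ∈ Π(μ, ν)} ∫ C(x, π_x) μ(dx)`, where `(π_x)` is a
regular disintegration of `π` with respect to its first marginal. -/
def V [StandardBorelSpace Y] [Nonempty Y] (C : X → PSpace Y t → EReal)
    (μ : ProbabilityMeasure X) (ν : PSpace Y t) : EReal :=
  ⨅ π ∈ couplings μ ν.toProb,
    eintegral (μ : Measure X) (fun x => costAt C x ((π : Measure (X × Y)).condKernel x))

/-- The conjugate `R_C ψ(x) = inf_{p ∈ 𝒫ᵗ(Y)} (p(ψ) + C(x, p))`. -/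
def RC (C : X → PSpace Y t → EReal) (ψ : Y → ℝ) (x : X) : EReal :=
  ⨅ p : PSpace Y t, ((∫ y, ψ y ∂p.toMeasure : ℝ) : EReal) + C x p

end Transport

end WeakTransport

end

set_option linter.unusedSectionVars false

/-! ### Weak convergence of probability measures on compact metrizable spaces. -/

namespace WeakTransport

open Filter Set

section CompactMetrizable

/-! The strategy is to solve a relaxed primal problem on a compact space and then to show that its
solution is an honest coupling.

Embed `X` in a compact `F`, and `Y` in a compact `E` on which `d(·, y₀)ᵗ` extends to a continuous
weight with values in `[0, ∞]`. Recording the image of a measure together with its moment places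
`𝒫ᵗ(Y)` in the compact space `𝒫(E) × [0, ∞]`. Wasserstein balls contain neighbourhoods pulled back
from there (`exists_isOpen_wasserstein_lt`), so the cost, shifted by a lower bound `K` to be
nonnegative, extends to a lower semicontinuous `f` on `F × (𝒫(E) × [0, ∞])` (`exists_extension`).

Weak duality (`dual_le`) is the integral of `R_C ψ(x) ≤ π_x(ψ) + C(x, π_x)`. For strong duality
(`le_dual`), take a real `a` above the dual value and put `m = a - K`. For finitely many test
functions, finite-dimensional Hahn–Banach separation shows that the marginal, moment and cost
constraints at level `m` are approximately solvable by finitely supported measures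
(`mem_closure_convexHull`, `exists_approx`): a separating functional would rescale to an admissible
dual pair of value above `m`. A limit point `Q` satisfies all the constraints and has cost at most
`m`. It does not charge the added boundary: the weight integral is at most the moment coordinate
almost everywhere, while the constraints bound the mean of the latter by that of the former, so the
two agree (`exists_limit`).

Such a `Q` is a coupling with randomized conditional laws. Replacing the law on `𝒫ᵗ(Y)` above each
`x` by its barycentre keeps both marginals and, by Jensen's inequality (`ConvexENNReal.jensen`),
does not raise the cost (`exists_coupling`). -/

instance (priority := 50) polishSpace_of_compact_metrizable (E : Type*) [TopologicalSpace E]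
    [CompactSpace E] [TopologicalSpace.MetrizableSpace E] : PolishSpace E := by
  let := TopologicalSpace.metrizableSpaceMetric E
  infer_instance

variable {E : Type*} [TopologicalSpace E] [CompactSpace E] [TopologicalSpace.MetrizableSpace E]
  [MeasurableSpace E] [BorelSpace E]

/-- A dense sequence of continuous functions on a compact metrizable space. -/
noncomputable def denseTest (E : Type*) [TopologicalSpace E] [CompactSpace E]
    [TopologicalSpace.MetrizableSpace E] : ℕ → C(E, ℝ) :=
  TopologicalSpace.denseSeq C(E, ℝ)

omit [TopologicalSpace.MetrizableSpace E] in
theorem integrable_continuousMap (F : C(E, ℝ)) (μ : Measure E) [IsFiniteMeasure μ] :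
    Integrable F μ :=
  (BoundedContinuousFunction.mkOfCompact F).integrable μ

omit [TopologicalSpace.MetrizableSpace E] in
theorem abs_integral_sub_le (F G : C(E, ℝ)) (μ : Measure E) [IsProbabilityMeasure μ] :
    |∫ x, F x ∂μ - ∫ x, G x ∂μ| ≤ ‖F - G‖ := by
  rw [← integral_sub (integrable_continuousMap F μ) (integrable_continuousMap G μ)]
  have := norm_integral_le_of_norm_le_const (μ := μ) (f := fun x => F x - G x) (C := ‖F - G‖)
    (ae_of_all _ fun x => (F - G).norm_coe_le_norm x)
  simpa using this

/-- A three-epsilon argument: integration against a probability measure is 1-Lipschitz in the sup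
norm. Countably many real constraints therefore suffice to prescribe a marginal. -/
theorem tendsto_of_forall_denseTest {ι : Type*} {l : Filter ι} {p : ι → ProbabilityMeasure E}
    {q : ProbabilityMeasure E}
    (h : ∀ j, Tendsto (fun i => ∫ x, denseTest E j x ∂(p i : Measure E)) l
      (𝓝 (∫ x, denseTest E j x ∂(q : Measure E)))) :
    Tendsto p l (𝓝 q) := by
  rw [ProbabilityMeasure.tendsto_iff_forall_integral_tendsto]
  intro f
  rw [Metric.tendsto_nhds]
  intro ε hε
  obtain ⟨j, hj⟩ := (TopologicalSpace.denseRange_denseSeq C(E, ℝ)).exists_dist_lt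
    f.toContinuousMap (show 0 < ε / 3 by positivity)
  rw [dist_eq_norm] at hj
  filter_upwards [Metric.tendsto_nhds.1 (h j) (ε / 3) (by positivity)] with i hi
  have h1 := abs_integral_sub_le f.toContinuousMap (denseTest E j) (p i : Measure E)
  have h2 := abs_integral_sub_le f.toContinuousMap (denseTest E j) (q : Measure E)
  change ‖f.toContinuousMap - denseTest E j‖ < _ at hj
  rw [Real.dist_eq] at hi ⊢
  change |∫ x, f.toContinuousMap x ∂(p i : Measure E) - ∫ x, f.toContinuousMap x ∂(q : Measure E)|
    < ε
  rw [abs_le] at h1 h2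
  rw [abs_lt] at hi ⊢
  constructor <;> linarith [h1.1, h1.2, h2.1, h2.2, hi.1, hi.2]

theorem eq_of_forall_denseTest {p q : ProbabilityMeasure E}
    (h : ∀ j, ∫ x, denseTest E j x ∂(p : Measure E) = ∫ x, denseTest E j x ∂(q : Measure E)) :
    p = q := by
  have h1 : Tendsto (fun _ : ℕ => p) atTop (𝓝 q) :=
    tendsto_of_forall_denseTest fun j => by rw [h j]; exact tendsto_const_nhds
  exact tendsto_nhds_unique tendsto_const_nhds h1

theorem isInducing_denseTest :
    IsInducing (fun (p : ProbabilityMeasure E) (j : ℕ) => ∫ x, denseTest E j x ∂(p : Measure E)) := by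
  rw [isInducing_iff_nhds]
  intro p
  apply le_antisymm
  · rw [← tendsto_iff_comap]
    refine Continuous.tendsto (continuous_pi fun j => ?_) p
    exact ProbabilityMeasure.continuous_integral_continuousMap _
  · have := tendsto_of_forall_denseTest (p := id) (q := p) (l := comap
      (fun (p : ProbabilityMeasure E) (j : ℕ) => ∫ x, denseTest E j x ∂(p : Measure E))
      (𝓝 fun j => ∫ x, denseTest E j x ∂(p : Measure E)))
      fun j => (((continuous_apply j).tendsto
        fun j => ∫ x, denseTest E j x ∂(p : Measure E)).comp tendsto_comap)
    rwa [Tendsto, map_id] at this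

theorem measurable_integral_probabilityMeasure {Ω : Type*} [MeasurableSpace Ω] {f : Ω → ℝ}
    (hf : Measurable f) : Measurable fun p : ProbabilityMeasure Ω => ∫ x, f x ∂(p : Measure Ω) := by
  let κ : ProbabilityTheory.Kernel (ProbabilityMeasure Ω) Ω :=
    ⟨fun p => (p : Measure Ω), measurable_subtype_coe⟩
  exact (StronglyMeasurable.integral_kernel (κ := κ) hf.stronglyMeasurable).measurable

theorem measurable_lintegral_probabilityMeasure {Ω : Type*} [MeasurableSpace Ω] {f : Ω → ℝ≥0∞}
    (hf : Measurable f) :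
    Measurable fun p : ProbabilityMeasure Ω => ∫⁻ x, f x ∂(p : Measure Ω) :=
  (Measure.measurable_lintegral hf).comp measurable_subtype_coe

/-- The evaluation σ-algebra and the weak Borel σ-algebra agree. Evaluations at closed sets are
limits of weakly continuous integrals; conversely the weak topology is induced by countably many
integrals, each measurable for evaluations. This makes kernels and Borel functions on `𝒫(E)`
compatible. -/
instance borelSpace_probabilityMeasure : BorelSpace (ProbabilityMeasure E) := by
  constructor
  apply le_antisymm
  · have : @Measurable (ProbabilityMeasure E) (Measure E) (borel _) _ (fun p => (p : Measure E)) := by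
      let : MeasurableSpace (ProbabilityMeasure E) := borel _
      have : BorelSpace (ProbabilityMeasure E) := ⟨rfl⟩
      refine Measurable.measure_of_isPiSystem_of_isProbabilityMeasure
        (S := {s | IsClosed s}) ?_ isPiSystem_isClosed ?_
      · rw [BorelSpace.measurable_eq (α := E), borel_eq_generateFrom_isClosed]
      · intro F hF
        let := TopologicalSpace.metrizableSpaceMetric E
        refine measurable_of_tendsto_metrizable (fun n => ?_) (tendsto_pi_nhds.2 fun p =>
          HasOuterApproxClosed.tendsto_lintegral_apprSeq hF (p : Measure E))
        exact (ProbabilityMeasure.continuous_lintegral_boundedContinuousFunction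
          (IsClosed.apprSeq hF n)).measurable
    exact measurable_iff_comap_le.1 this
  · have h := (isInducing_denseTest (E := E)).eq_induced
    rw [h, borel_comap, ← BorelSpace.measurable_eq (α := ℕ → ℝ), ← measurable_iff_comap_le]
    exact measurable_pi_lambda _ fun j =>
      measurable_integral_probabilityMeasure (denseTest E j).continuous.measurable

omit [CompactSpace E] in
/-- Portmanteau theorem for lower semicontinuous functions. -/
theorem lintegral_le_liminf_of_lowerSemicontinuous {f : E → ℝ≥0∞} (hf : LowerSemicontinuous f)
    {P : ℕ → ProbabilityMeasure E} {Q : ProbabilityMeasure E} (h : Tendsto P atTop (𝓝 Q)) :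
    ∫⁻ x, f x ∂(Q : Measure E) ≤ liminf (fun n => ∫⁻ x, f x ∂(P n : Measure E)) atTop := by
  let := TopologicalSpace.metrizableSpaceMetric E
  have hfm : Measurable f := hf.measurable
  have hmeas (k : ℕ) : Measurable fun x => min (f x) (k : ℝ≥0∞) := hfm.min measurable_const
  have key (k : ℕ) : ∫⁻ x, min (f x) k ∂(Q : Measure E)
      ≤ liminf (fun n => ∫⁻ x, f x ∂(P n : Measure E)) atTop := by
    set g : E → ℝ := fun x => (min (f x) (k : ℝ≥0∞)).toReal with hg
    have hfin (x : E) : min (f x) (k : ℝ≥0∞) ≠ ∞ :=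
      ((min_le_right _ _).trans_lt (ENNReal.natCast_lt_top k)).ne
    have hgf (x : E) : ENNReal.ofReal (g x) = min (f x) k := ENNReal.ofReal_toReal (hfin x)
    -- The layer cake formula reduces the claim to superlevel sets, which are open; the Portmanteau
    -- inequality for open sets and Fatou's lemma finish. The truncation at `k` makes `g`
    -- real-valued.
    have hlayer (ρ : Measure E) :
        ∫⁻ x, min (f x) k ∂ρ = ∫⁻ s in Ioi (0 : ℝ), ρ {x | s < g x} := by
      simp_rw [← hgf]
      exact lintegral_eq_lintegral_meas_lt ρ (ae_of_all _ fun x => ENNReal.toReal_nonneg)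
        (hmeas k).ennreal_toReal.aemeasurable
    have hopen (s : ℝ) (hs : 0 ≤ s) : IsOpen {x | s < g x} := by
      have : {x | s < g x} = {x | ENNReal.ofReal s < f x} ∩ {_x | ENNReal.ofReal s < k} := by
        ext x
        simp only [mem_ofPred_eq, mem_inter_iff, hg]
        rw [← ENNReal.ofReal_lt_iff_lt_toReal hs (hfin x), lt_min_iff]
      rw [this]
      exact (hf.isOpen_preimage _).inter isOpen_const
    calc ∫⁻ x, min (f x) k ∂(Q : Measure E)
        = ∫⁻ s in Ioi (0 : ℝ), (Q : Measure E) {x | s < g x} := hlayer _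
      _ ≤ ∫⁻ s in Ioi (0 : ℝ), liminf (fun n => (P n : Measure E) {x | s < g x}) atTop :=
          setLIntegral_mono' measurableSet_Ioi fun s hs =>
            ProbabilityMeasure.le_liminf_measure_open_of_tendsto h (hopen s (le_of_lt hs))
      _ ≤ liminf (fun n => ∫⁻ s in Ioi (0 : ℝ), (P n : Measure E) {x | s < g x}) atTop := by
          refine lintegral_liminf_le fun n => Antitone.measurable fun a b hab => measure_mono ?_
          exact fun x (hx : b < g x) => hab.trans_lt hx
      _ = liminf (fun n => ∫⁻ x, min (f x) k ∂(P n : Measure E)) atTop := by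
          simp_rw [hlayer]
      _ ≤ _ := liminf_le_liminf (Eventually.of_forall fun n =>
          lintegral_mono fun x => min_le_left _ _)
  have hsup : ∫⁻ x, f x ∂(Q : Measure E) = ⨆ k : ℕ, ∫⁻ x, min (f x) k ∂(Q : Measure E) := by
    rw [← lintegral_iSup hmeas fun a b hab x => min_le_min_left _ (by exact_mod_cast hab)]
    refine lintegral_congr fun x => ?_
    rw [← inf_iSup_eq, ENNReal.iSup_natCast, inf_top_eq]
  rw [hsup]
  exact iSup_le key

end CompactMetrizable

end WeakTransport

/-! ### Couplings built from partitions of unity. -/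

namespace WeakTransport

open Filter Set

section Coupling

variable {Y : Type*} [MetricSpace Y] [MeasurableSpace Y] [BorelSpace Y]
  [SecondCountableTopology Y] {t : ℝ}

theorem measurable_edist_rpow (t : ℝ) (y₀ : Y) : Measurable fun y : Y => edist y y₀ ^ t :=
  (measurable_id.edist measurable_const).pow_const t

omit [MetricSpace Y] [MeasurableSpace Y] [BorelSpace Y] [SecondCountableTopology Y] in
theorem map_finsetSum_measure {α β κ : Type*} [MeasurableSpace α] [MeasurableSpace β]
    {s : Finset κ} (m : κ → Measure α) {f : α → β} (hf : Measurable f) :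
    (∑ i ∈ s, m i).map f = ∑ i ∈ s, (m i).map f := by
  ext A hA
  simp [Measure.map_apply hf hA, Measure.finsetSum_apply]

omit [BorelSpace Y] in
/-- The normalized product of two finite measures of the same mass is a coupling of them. -/
theorem exists_coupling_of_mass_eq (α β : Measure Y) [IsFiniteMeasure α] [IsFiniteMeasure β]
    (h : α univ = β univ) :
    ∃ γ : Measure (Y × Y), γ.fst = α ∧ γ.snd = β ∧ γ ≪ α.prod β := by
  rcases eq_or_ne (α univ) 0 with h0 | h0
  · refine ⟨0, ?_, ?_, Measure.AbsolutelyContinuous.zero _⟩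
    · simp [Measure.measure_univ_eq_zero.1 h0]
    · have h0' : β univ = 0 := by rw [← h, h0]
      simp [Measure.measure_univ_eq_zero.1 h0']
  · refine ⟨(α univ)⁻¹ • α.prod β, ?_, ?_, Measure.smul_absolutelyContinuous⟩
    · rw [Measure.fst, Measure.map_smul, Measure.map_fst_prod, smul_smul, h,
        ENNReal.inv_mul_cancel (h ▸ h0) (measure_ne_top _ _), one_smul]
    · rw [Measure.snd, Measure.map_smul, Measure.map_snd_prod, smul_smul,
        ENNReal.inv_mul_cancel h0 (measure_ne_top _ _), one_smul]

omit [MeasurableSpace Y] [BorelSpace Y] [SecondCountableTopology Y] in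
theorem edist_rpow_le (ht : 1 ≤ t) (y₀ y y' : Y) :
    edist y y' ^ t ≤ 2 ^ (t - 1) * (edist y y₀ ^ t + edist y' y₀ ^ t) :=
  (ENNReal.rpow_le_rpow (edist_triangle_right y y' y₀) (by linarith)).trans
    (ENNReal.rpow_add_le_mul_rpow_add_rpow _ _ ht)

theorem cost_le_moments (ht : 1 ≤ t) (y₀ : Y) (γ : Measure (Y × Y)) :
    ∫⁻ z, edist z.1 z.2 ^ t ∂γ
      ≤ 2 ^ (t - 1) * (∫⁻ y, edist y y₀ ^ t ∂γ.fst + ∫⁻ y, edist y y₀ ^ t ∂γ.snd) := by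
  have hm := measurable_edist_rpow t y₀
  rw [Measure.fst, Measure.snd, lintegral_map hm measurable_fst, lintegral_map hm measurable_snd,
    ← lintegral_add_left (by exact hm.comp measurable_fst), ← lintegral_const_mul]
  · exact lintegral_mono fun z => edist_rpow_le ht y₀ z.1 z.2
  · exact (hm.comp measurable_fst).add (hm.comp measurable_snd)

omit [MetricSpace Y] [BorelSpace Y] [SecondCountableTopology Y] in
theorem lintegral_smul_withDensity_le (p : Measure Y) {f D : Y → ℝ≥0∞} (hf : Measurable f)
    (hD : Measurable D) {R : ℝ≥0∞} (hR : ∀ y, f y ≠ 0 → D y ≤ R) (c : ℝ≥0∞) :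
    ∫⁻ y, D y ∂(c • p.withDensity f) ≤ R * (c * ∫⁻ y, f y ∂p) := by
  rw [lintegral_smul_measure, lintegral_withDensity_eq_lintegral_mul _ hf hD, smul_eq_mul,
    mul_left_comm, ← lintegral_const_mul _ hf]
  refine mul_le_mul_right (lintegral_mono fun y => ?_) _
  rcases eq_or_ne (f y) 0 with h | h
  · simp [h]
  · simp only [Pi.mul_apply]
    rw [mul_comm]
    exact mul_le_mul_left (hR y h) _

/-- A coupling of `p` and `q` built from a partition of unity `(f₀, f₁, …, fₙ)`: the pieces of
`p` and `q` under `fᵢ`, `1 ≤ i`, are matched with one another as far as possible. -/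
theorem exists_coupling_cost_le (ht : 1 ≤ t) (y₀ : Y) (p q : Measure Y) [IsProbabilityMeasure p]
    [IsProbabilityMeasure q] {n : ℕ} {f : Fin n → Y → ℝ≥0∞} {f₀ : Y → ℝ≥0∞}
    (hf : ∀ i, Measurable (f i)) (hf₀ : Measurable f₀) (hsum : ∀ y, f₀ y + ∑ i, f i y = 1)
    {δ R : ℝ≥0∞} (hδ : ∀ i y y', f i y ≠ 0 → f i y' ≠ 0 → edist y y' ≤ δ)
    (hR : ∀ i y, f i y ≠ 0 → edist y y₀ ^ t ≤ R) :
    ∃ π : Measure (Y × Y), π.fst = p ∧ π.snd = q ∧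
      ∫⁻ z, edist z.1 z.2 ^ t ∂π ≤ δ ^ t + 2 ^ (t - 1) *
        ((∫⁻ y, f₀ y * edist y y₀ ^ t ∂p + R * ∑ i, (∫⁻ y, f i y ∂p - ∫⁻ y, f i y ∂q)) +
          (∫⁻ y, f₀ y * edist y y₀ ^ t ∂q + R * ∑ i, (∫⁻ y, f i y ∂q - ∫⁻ y, f i y ∂p))) := by
  have hf1 (i y) : f i y ≤ 1 := by
    rw [← hsum y]
    exact (Finset.single_le_sum (f := fun i => f i y) (fun _ _ => zero_le) (Finset.mem_univ i)).trans
      le_add_self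
  have hint {g : Y → ℝ≥0∞} (hg : ∀ y, g y ≤ 1) (r : Measure Y) [IsProbabilityMeasure r] :
      ∫⁻ y, g y ∂r ≤ 1 := by
    calc ∫⁻ y, g y ∂r ≤ ∫⁻ _, 1 ∂r := lintegral_mono hg
      _ = 1 := by simp
  -- the part of `r` under `f i` of mass `θ i`, and what remains of `r`
  have piece (r s : Measure Y) [IsProbabilityMeasure r] [IsProbabilityMeasure s] :
      ∃ (α : Fin n → Measure Y) (α' : Measure Y), (∑ i, α i) + α' = r ∧
        (∀ i, α i univ = min (∫⁻ y, f i y ∂r) (∫⁻ y, f i y ∂s)) ∧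
        (∀ i, ∀ᵐ y ∂α i, f i y ≠ 0) ∧
        ∫⁻ y, edist y y₀ ^ t ∂α' ≤
          ∫⁻ y, f₀ y * edist y y₀ ^ t ∂r + R * ∑ i, (∫⁻ y, f i y ∂r - ∫⁻ y, f i y ∂s) := by
    set a : Fin n → ℝ≥0∞ := fun i => ∫⁻ y, f i y ∂r with ha
    set b : Fin n → ℝ≥0∞ := fun i => ∫⁻ y, f i y ∂s with hb
    have hafin (i) : a i ≠ ∞ := ((hint (hf1 i) r).trans_lt ENNReal.one_lt_top).ne
    -- The fraction of the `i`-th piece of `r` that `s` can match. If the piece is null, this is `0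
    -- / 0 = 0`.
    set c : Fin n → ℝ≥0∞ := fun i => min (a i) (b i) / a i with hc
    have hc1 (i) : c i ≤ 1 := ENNReal.div_le_of_le_mul (by rw [one_mul]; exact min_le_left _ _)
    have hca (i) : c i * a i = min (a i) (b i) := by
      rcases eq_or_ne (a i) 0 with h | h
      · simp [h]
      · exact ENNReal.div_mul_cancel h (hafin i)
    refine ⟨fun i => c i • r.withDensity (f i),
      r.withDensity f₀ + ∑ i, (1 - c i) • r.withDensity (f i), ?_, fun i => ?_, fun i => ?_, ?_⟩
    · rw [add_left_comm, ← Finset.sum_add_distrib]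
      simp_rw [← add_smul]
      have h1 (i) : c i + (1 - c i) = 1 := add_tsub_cancel_of_le (hc1 i)
      simp_rw [h1, one_smul]
      have h2 : r.withDensity f₀ + ∑ i, r.withDensity (f i)
          = r.withDensity (f₀ + ∑ i, f i) := by
        rw [withDensity_add_left hf₀]
        congr 1
        ext A hA
        rw [Measure.finsetSum_apply, withDensity_apply _ hA]
        simp_rw [withDensity_apply _ hA, Finset.sum_apply]
        rw [lintegral_finsetSum _ fun i _ => hf i]
      rw [h2]
      have h3 : f₀ + ∑ i, f i = 1 := by
        ext y; simpa using hsum y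
      rw [h3, withDensity_one]
    · rw [Measure.smul_apply, withDensity_apply _ MeasurableSet.univ, Measure.restrict_univ,
        smul_eq_mul]
      exact hca i
    · have h : ∀ᵐ y ∂r.withDensity (f i), f i y ≠ 0 := by
        rw [ae_withDensity_iff (hf i)]
        exact ae_of_all _ fun y hy => hy
      exact Measure.smul_absolutelyContinuous.ae_le h
    · have hm := measurable_edist_rpow t y₀
      rw [lintegral_add_measure, lintegral_withDensity_eq_lintegral_mul _ hf₀ hm,
        lintegral_finsetSum_measure, Finset.mul_sum]
      refine add_le_add le_rfl (Finset.sum_le_sum fun i _ => ?_)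
      refine (lintegral_smul_withDensity_le r (hf i) hm (hR i) _).trans ?_
      change R * ((1 - c i) * a i) ≤ R * (a i - b i)
      rw [ENNReal.sub_mul fun _ _ => hafin i, hca, one_mul, tsub_min]
  obtain ⟨α, α', hα, hαm, hαf, hαR⟩ := piece p q
  obtain ⟨β, β', hβ, hβm, hβf, hβR⟩ := piece q p
  have piece_le {r : Measure Y} {κ : Fin n → Measure Y} {κ' : Measure Y}
      (h : (∑ i, κ i) + κ' = r) : (∀ i, κ i ≤ r) ∧ κ' ≤ r := by
    refine ⟨fun i => Measure.le_iff.2 fun A _ => ?_, Measure.le_iff.2 fun A _ => ?_⟩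
    · rw [← h, Measure.add_apply, Measure.finsetSum_apply]
      exact (Finset.single_le_sum (f := fun i => κ i A) (fun _ _ => zero_le)
        (Finset.mem_univ i)).trans le_self_add
    · rw [← h, Measure.add_apply]
      exact le_add_self
  obtain ⟨hαle, hα'le⟩ := piece_le hα
  obtain ⟨hβle, hβ'le⟩ := piece_le hβ
  have hαfin (i) : IsFiniteMeasure (α i) := isFiniteMeasure_of_le p (hαle i)
  have hβfin (i) : IsFiniteMeasure (β i) := isFiniteMeasure_of_le q (hβle i)
  have : IsFiniteMeasure α' := isFiniteMeasure_of_le p hα'le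
  have : IsFiniteMeasure β' := isFiniteMeasure_of_le q hβ'le
  have hmass (i) : α i univ = β i univ := by rw [hαm, hβm, min_comm]
  have hα1 : (∑ i, α i univ) + α' univ = 1 := by
    have := congrArg (fun m : Measure Y => m univ) hα
    simpa [Measure.finsetSum_apply] using this
  have hβ1 : (∑ i, β i univ) + β' univ = 1 := by
    have := congrArg (fun m : Measure Y => m univ) hβ
    simpa [Measure.finsetSum_apply] using this
  have hmass' : α' univ = β' univ := by
    simp_rw [hmass] at hα1
    rw [← hβ1] at hα1
    exact (ENNReal.add_right_inj (ENNReal.sum_ne_top.2 fun i _ => measure_ne_top _ _)).1 hα1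
  choose γ hγ1 hγ2 hγ using fun i => exists_coupling_of_mass_eq (α i) (β i) (hmass i)
  obtain ⟨γ', hγ'1, hγ'2, -⟩ := exists_coupling_of_mass_eq α' β' hmass'
  have hfst : ((∑ i, γ i) + γ').fst = p := by
    have h (i) : (γ i).map Prod.fst = α i := hγ1 i
    rw [Measure.fst, Measure.map_add _ _ measurable_fst, map_finsetSum_measure _ measurable_fst]
    simp_rw [h]
    rw [← Measure.fst, hγ'1, hα]
  have hsnd : ((∑ i, γ i) + γ').snd = q := by
    have h (i) : (γ i).map Prod.snd = β i := hγ2 i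
    rw [Measure.snd, Measure.map_add _ _ measurable_snd, map_finsetSum_measure _ measurable_snd]
    simp_rw [h]
    rw [← Measure.snd, hγ'2, hβ]
  refine ⟨(∑ i, γ i) + γ', hfst, hsnd, ?_⟩
  rw [lintegral_add_measure, lintegral_finsetSum_measure]
  refine add_le_add ?_ ?_
  · calc ∑ i, ∫⁻ z, edist z.1 z.2 ^ t ∂γ i ≤ ∑ i, δ ^ t * α i univ := by
          refine Finset.sum_le_sum fun i _ => ?_
          -- Since `γ i ≪ (α i).prod (β i)`, both coordinates lie almost surely where `f i ≠ 0`, a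
          -- set of diameter at most `δ`. Only the unmatched remainder `γ'` has to be estimated by
          -- moments.
          have h1 : ∀ᵐ z ∂γ i, edist z.1 z.2 ^ t ≤ δ ^ t := by
            refine (hγ i).ae_le ?_
            filter_upwards [Measure.quasiMeasurePreserving_fst.ae (hαf i),
              Measure.quasiMeasurePreserving_snd.ae (hβf i)] with z hz1 hz2
            exact ENNReal.rpow_le_rpow (hδ i _ _ hz1 hz2) (by linarith)
          refine (lintegral_mono_ae h1).trans ?_
          rw [lintegral_const, ← hγ1 i, Measure.fst_univ]
      _ = δ ^ t * ∑ i, α i univ := by rw [Finset.mul_sum]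
      _ ≤ δ ^ t * 1 := by
          refine mul_le_mul_right ?_ _
          rw [← hα1]; exact le_self_add
      _ = δ ^ t := mul_one _
  · refine (cost_le_moments ht y₀ γ').trans (mul_le_mul_right ?_ _)
    rw [hγ'1, hγ'2]
    exact add_le_add hαR hβR

end Coupling

end WeakTransport

/-! ### The embedding of `𝒫ᵗ(Y)` by image measure and moment. -/

namespace WeakTransport

open Filter Set

/-- An embedding of `Y` into `E` along which `y ↦ d(y, y₀)ᵗ` extends to a continuous function
with values in `[0, ∞]`. -/
structure MomentEmbedding (Y E : Type*) [MetricSpace Y] [TopologicalSpace E] (t : ℝ) where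
  /-- the embedding -/
  toFun : Y → E
  isEmbedding : IsEmbedding toFun
  /-- the base point -/
  base : Y
  /-- the extension of `y ↦ d(y, y₀)ᵗ` -/
  weight : E → ℝ≥0∞
  continuous_weight : Continuous weight
  weight_apply : ∀ y, weight (toFun y) = edist y base ^ t

/-- The `t`-th moment of `p` about `y₀`. -/
noncomputable def PSpace.moment {Y : Type*} [MetricSpace Y] [MeasurableSpace Y] {t : ℝ} (y₀ : Y)
    (p : PSpace Y t) : ℝ≥0∞ :=
  ∫⁻ y, edist y y₀ ^ t ∂p.toMeasure

section

variable {Y : Type*} [MetricSpace Y] [MeasurableSpace Y] [BorelSpace Y]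
  [SecondCountableTopology Y] {t : ℝ}

instance PSpace.isProbabilityMeasure_toMeasure (p : PSpace Y t) :
    IsProbabilityMeasure p.toMeasure :=
  inferInstanceAs (IsProbabilityMeasure (p.toProb : Measure Y))

theorem PSpace.toMeasure_injective : Function.Injective (PSpace.toMeasure : PSpace Y t → Measure Y) :=
  fun _ _ h => PSpace.ext (Subtype.ext h)

theorem lintegral_edist_rpow_lt_top (ht : 1 ≤ t) (p : Measure Y) [IsFiniteMeasure p] {y₀ : Y}
    (h : ∫⁻ y, edist y y₀ ^ t ∂p < ∞) (y₁ : Y) : ∫⁻ y, edist y y₁ ^ t ∂p < ∞ := by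
  calc ∫⁻ y, edist y y₁ ^ t ∂p
      ≤ ∫⁻ y, 2 ^ (t - 1) * (edist y y₀ ^ t + edist y₁ y₀ ^ t) ∂p :=
        lintegral_mono fun y => edist_rpow_le ht y₀ y y₁
    _ = 2 ^ (t - 1) * (∫⁻ y, edist y y₀ ^ t ∂p + edist y₁ y₀ ^ t * p univ) := by
        rw [lintegral_const_mul _ ((measurable_edist_rpow t y₀).add_const _),
          lintegral_add_left (measurable_edist_rpow t y₀), lintegral_const]
    _ < ∞ := by
        refine ENNReal.mul_lt_top ?_ (ENNReal.add_lt_top.2 ⟨h, ENNReal.mul_lt_top ?_ (measure_lt_top _ _)⟩)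
        · exact ENNReal.rpow_lt_top_of_nonneg (by linarith) (by simp)
        · exact ENNReal.rpow_lt_top_of_nonneg (by linarith) (edist_ne_top _ _)

theorem PSpace.moment_lt_top (ht : 1 ≤ t) (y₀ : Y) (p : PSpace Y t) : p.moment y₀ < ∞ := by
  obtain ⟨y, hy⟩ := p.finite_moment
  exact lintegral_edist_rpow_lt_top ht p.toMeasure hy y₀

theorem wasserstein_lt {p q : PSpace Y t} (ht : 1 ≤ t) {ε : ℝ≥0∞} (π : Measure (Y × Y))
    (h1 : π.fst = p.toMeasure) (h2 : π.snd = q.toMeasure)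
    (h : ∫⁻ z, edist z.1 z.2 ^ t ∂π < ε ^ t) : wasserstein p q < ε := by
  have : IsProbabilityMeasure π := ⟨by rw [← Measure.fst_univ, h1]; exact measure_univ⟩
  have h3 : (⨅ π ∈ couplings p.toProb q.toProb,
      ∫⁻ z, edist z.1 z.2 ^ t ∂(π : Measure (Y × Y))) < ε ^ t :=
    (iInf₂_le (⟨π, this⟩ : ProbabilityMeasure (Y × Y)) ⟨h1, h2⟩).trans_lt h
  unfold wasserstein
  calc _ < (ε ^ t) ^ (1 / t) := ENNReal.rpow_lt_rpow h3 (by positivity)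
    _ = ε := by rw [← ENNReal.rpow_mul, mul_one_div_cancel (by positivity), ENNReal.rpow_one]

variable {E : Type*} [TopologicalSpace E] [MeasurableSpace E] [BorelSpace E]

namespace MomentEmbedding

theorem measurable (e : MomentEmbedding Y E t) : Measurable e.toFun :=
  e.isEmbedding.continuous.measurable

/-- The map `p ↦ (ι_* p, ∫ d(y, y₀)ᵗ p(dy))`. -/
noncomputable def embed (e : MomentEmbedding Y E t) (p : PSpace Y t) :
    ProbabilityMeasure E × ℝ≥0∞ :=
  (p.toProb.map e.measurable.aemeasurable, p.moment e.base)

theorem embed_fst (e : MomentEmbedding Y E t) (p : PSpace Y t) :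
    ((e.embed p).1 : Measure E) = p.toMeasure.map e.toFun := rfl

theorem lintegral_weight (e : MomentEmbedding Y E t) (p : PSpace Y t) :
    ∫⁻ z, e.weight z ∂((e.embed p).1 : Measure E) = p.moment e.base := by
  rw [embed_fst, lintegral_map e.continuous_weight.measurable e.measurable]
  simp_rw [e.weight_apply]
  rfl

theorem lintegral_embed (e : MomentEmbedding Y E t) (p : PSpace Y t) {f : E → ℝ≥0∞}
    (hf : Measurable f) :
    ∫⁻ z, f z ∂((e.embed p).1 : Measure E) = ∫⁻ y, f (e.toFun y) ∂p.toMeasure := by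
  rw [embed_fst, lintegral_map hf e.measurable]

end MomentEmbedding

end

/-! ### Weak convergence plus convergence of moments controls the Wasserstein distance. -/

section WassersteinNhds

variable {Y : Type*} [MetricSpace Y] [MeasurableSpace Y] [BorelSpace Y]
  [SecondCountableTopology Y] {t : ℝ}
  {E : Type*} [MetricSpace E] [CompactSpace E] [MeasurableSpace E] [BorelSpace E]

/-- Countably many balls that cover the image of `Y`, on which the preimage of the embedding is
small and the weight is bounded. -/
theorem MomentEmbedding.exists_cover (e : MomentEmbedding Y E t) (ht : 1 ≤ t) {δ : ℝ}
    (hδ : 0 < δ) :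
    ∃ (c : ℕ → E) (r : ℕ → ℝ) (R : ℕ → NNReal),
      (∀ y, ∃ i, dist (e.toFun y) (c i) < r i) ∧
      (∀ i y y', dist (e.toFun y) (c i) < r i → dist (e.toFun y') (c i) < r i →
        edist y y' ≤ ENNReal.ofReal δ) ∧
      ∀ i z, dist z (c i) < r i → e.weight z ≤ R i := by
  have h1 (y : Y) : ∃ r > 0, (∀ y', dist (e.toFun y') (e.toFun y) < r → dist y' y < δ / 2) ∧
      ∀ z, dist z (e.toFun y) < r → e.weight z < edist y e.base ^ t + 1 := by
    obtain ⟨r₁, hr₁, h₁⟩ := Metric.mem_nhds_iff.1 (show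
      {z | e.weight z < edist y e.base ^ t + 1} ∈ 𝓝 (e.toFun y) by
        refine e.continuous_weight.continuousAt.eventually_lt_const ?_
        rw [e.weight_apply]
        refine ENNReal.lt_add_right ?_ one_ne_zero
        exact (ENNReal.rpow_lt_top_of_nonneg (by linarith) (edist_ne_top _ _)).ne)
    have h₂ : Metric.ball y (δ / 2) ∈ 𝓝 y := Metric.ball_mem_nhds y (by positivity)
    rw [e.isEmbedding.nhds_eq_comap, mem_comap] at h₂
    obtain ⟨U, hU, hUy⟩ := h₂
    obtain ⟨r₂, hr₂, h₂⟩ := Metric.mem_nhds_iff.1 hU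
    refine ⟨min r₁ r₂, lt_min hr₁ hr₂, fun y' hy' => ?_, fun z hz => ?_⟩
    · exact hUy (h₂ (hy'.trans_le (min_le_right _ _)))
    · exact h₁ (hz.trans_le (min_le_left _ _))
  choose r hr hr1 hr2 using h1
  obtain ⟨S, hS, hcov⟩ := TopologicalSpace.countable_cover_nhds (α := Y)
    (f := fun y => e.toFun ⁻¹' Metric.ball (e.toFun y) (r y)) fun y =>
      e.isEmbedding.continuous.continuousAt.preimage_mem_nhds (Metric.ball_mem_nhds _ (hr y))
  have hne : S.Nonempty := by
    by_contra h
    rw [not_nonempty_iff_eq_empty] at h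
    simp only [h, mem_empty_iff_false, iUnion_of_empty, iUnion_empty] at hcov
    exact (hcov ▸ mem_univ e.base : e.base ∈ (∅ : Set Y))
  obtain ⟨s, rfl⟩ := hS.exists_eq_range hne
  refine ⟨fun i => e.toFun (s i), fun i => r (s i),
    fun i => (edist (s i) e.base ^ t + 1).toNNReal, fun y => ?_, fun i y y' hy hy' => ?_,
    fun i z hz => ?_⟩
  · have := hcov ▸ mem_univ y
    simpa using this
  · rw [edist_dist]
    refine ENNReal.ofReal_le_ofReal ?_
    have := dist_triangle_right y y' (s i)
    linarith [hr1 _ _ hy, hr1 _ _ hy']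
  · rw [ENNReal.coe_toNNReal]
    · exact (hr2 _ _ hz).le
    · refine ENNReal.add_ne_top.2 ⟨?_, ENNReal.one_ne_top⟩
      exact (ENNReal.rpow_lt_top_of_nonneg (by linarith) (edist_ne_top _ _)).ne

/-- `𝒲ₜ`-balls contain neighbourhoods for the topology of weak convergence together with
convergence of the `t`-th moments. -/
theorem MomentEmbedding.exists_isOpen_wasserstein_lt (e : MomentEmbedding Y E t) (ht : 1 ≤ t)
    (p : PSpace Y t) {ε : ℝ≥0∞} (hε : 0 < ε) :
    ∃ U : Set (ProbabilityMeasure E × ℝ≥0∞), IsOpen U ∧ e.embed p ∈ U ∧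
      ∀ q, e.embed q ∈ U → wasserstein p q < ε := by
  obtain ⟨δ, hδ, hδε⟩ : ∃ δ : ℝ, 0 < δ ∧ ENNReal.ofReal δ < ε := by
    obtain ⟨δ, hδ, hδε⟩ := ENNReal.lt_iff_exists_nnreal_btwn.1 hε
    exact ⟨δ, by exact_mod_cast hδ, by simpa using hδε⟩
  have hδε' : ENNReal.ofReal δ ^ t < ε ^ t := ENNReal.rpow_lt_rpow hδε (by linarith)
  obtain ⟨c, r, R, hcov, hdiam, hR⟩ := e.exists_cover ht hδ
  -- Tent functions on the covering balls, normalized to a partition of unity. The balls cover the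
  -- image of `Y` but perhaps not `E`, so `w n > 0` keeps the denominators nonzero; as `w n → 0`,
  -- the leftover `f₀ n` vanishes in the limit on the image of `Y`.
  let v : ℕ → C(E, NNReal) := fun i =>
    ⟨fun z => (r i - dist z (c i)).toNNReal, by fun_prop⟩
  let w : ℕ → NNReal := fun n => ((n : NNReal) + 1)⁻¹
  have hw (n) : w n ≠ 0 := by positivity
  have hden (n z) : w n + ∑ j ∈ Finset.range n, v j z ≠ 0 :=
    (add_pos_of_pos_of_nonneg (pos_iff_ne_zero.2 (hw n)) zero_le).ne'
  let f : ℕ → ℕ → C(E, NNReal) := fun n i =>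
    ⟨fun z => v i z / (w n + ∑ j ∈ Finset.range n, v j z),
      Continuous.div₀ (by fun_prop) (by fun_prop) (hden n)⟩
  let f₀ : ℕ → C(E, NNReal) := fun n =>
    ⟨fun z => w n / (w n + ∑ j ∈ Finset.range n, v j z),
      Continuous.div₀ (by fun_prop) (by fun_prop) (hden n)⟩
  have hsum (n z) : f₀ n z + ∑ i ∈ Finset.range n, f n i z = 1 := by
    change w n / _ + ∑ i ∈ Finset.range n, v i z / _ = 1
    rw [← Finset.sum_div, ← add_div, div_self (hden n z)]
  have hsupp {n i z} (h : f n i z ≠ 0) : dist z (c i) < r i := by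
    by_contra h'
    refine h ?_
    change (r i - dist z (c i)).toNNReal / _ = 0
    rw [Real.toNNReal_of_nonpos (by linarith), zero_div]
  have hmom := p.moment_lt_top ht e.base
  have hDm := measurable_edist_rpow (Y := Y) t e.base
  have hfm (n i) : Measurable fun y => (f n i (e.toFun y) : ℝ≥0∞) :=
    ((f n i).continuous.measurable.comp e.measurable).coe_nnreal_ennreal
  have hf₀m (n) : Measurable fun y => (f₀ n (e.toFun y) : ℝ≥0∞) :=
    ((f₀ n).continuous.measurable.comp e.measurable).coe_nnreal_ennreal
  have hf₀1 (n z) : f₀ n z ≤ 1 := by rw [← hsum n z]; exact le_self_add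
  let T : ℕ → ℝ≥0∞ := fun n => ∫⁻ y, f₀ n (e.toFun y) * edist y e.base ^ t ∂p.toMeasure
  have hT : Tendsto T atTop (𝓝 0) := by
    have h0 : ∫⁻ _ : Y, (0 : ℝ≥0∞) ∂p.toMeasure = 0 := lintegral_zero
    rw [← h0]
    refine tendsto_lintegral_of_dominated_convergence (fun y => edist y e.base ^ t)
      (fun n => (hf₀m n).mul hDm) (fun n => ae_of_all _ fun y => ?_) hmom.ne
      (ae_of_all _ fun y => ?_)
    · calc (f₀ n (e.toFun y) : ℝ≥0∞) * edist y e.base ^ t ≤ 1 * edist y e.base ^ t :=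
          mul_le_mul_left (by exact_mod_cast hf₀1 n _) _
        _ = _ := one_mul _
    · have hfin : edist y e.base ^ t ≠ ∞ :=
        (ENNReal.rpow_lt_top_of_nonneg (by linarith) (edist_ne_top _ _)).ne
      obtain ⟨i, hi⟩ := hcov y
      have hvi : 0 < v i (e.toFun y) := Real.toNNReal_pos.2 (by linarith)
      have h1 : Tendsto (fun n => f₀ n (e.toFun y)) atTop (𝓝 0) := by
        have h2 : Tendsto (fun n => w n / v i (e.toFun y)) atTop (𝓝 0) := by
          have h3 : Tendsto w atTop (𝓝 0) := by
            rw [← NNReal.tendsto_coe]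
            simpa [w, one_div] using tendsto_one_div_add_atTop_nhds_zero_nat (𝕜 := ℝ)
          simpa using h3.div_const (v i (e.toFun y))
        refine tendsto_of_tendsto_of_tendsto_of_le_of_le' tendsto_const_nhds h2
          (Eventually.of_forall fun _ => zero_le) ?_
        filter_upwards [eventually_gt_atTop i] with n hn
        refine div_le_div_of_nonneg_left zero_le hvi ?_
        exact (Finset.single_le_sum (f := fun j => v j (e.toFun y)) (fun _ _ => zero_le)
          (Finset.mem_range.2 hn)).trans le_add_self
      have := ENNReal.Tendsto.mul_const (b := edist y e.base ^ t)
        (ENNReal.tendsto_coe.2 h1) (Or.inr hfin)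
      simpa using this
  obtain ⟨n, hn⟩ : ∃ n, ENNReal.ofReal δ ^ t + 2 ^ (t - 1) * (T n + T n) < ε ^ t := by
    have h2 : (2 : ℝ≥0∞) ^ (t - 1) ≠ ∞ :=
      (ENNReal.rpow_lt_top_of_nonneg (by linarith) (by simp)).ne
    have : Tendsto (fun n => ENNReal.ofReal δ ^ t + 2 ^ (t - 1) * (T n + T n)) atTop
        (𝓝 (ENNReal.ofReal δ ^ t + 2 ^ (t - 1) * (0 + 0))) :=
      (ENNReal.Tendsto.const_mul (hT.add hT) (Or.inr h2)).const_add _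
    rw [add_zero, mul_zero, add_zero] at this
    exact (this.eventually_lt_const hδε').exists
  -- Truncating the weight at `R i` changes nothing where `f n i ≠ 0`, and makes the product a
  -- finite continuous function.
  let H : ℕ → C(E, NNReal) := fun i => f n i * ⟨fun z => (min (e.weight z) (R i)).toNNReal, by
    refine continuous_iff_continuousAt.2 fun z => ?_
    exact (ENNReal.tendsto_toNNReal ((min_le_right _ _).trans_lt ENNReal.coe_lt_top).ne).comp
      ((e.continuous_weight.min continuous_const).tendsto z)⟩
  have hH (i) (q : PSpace Y t) : ∫⁻ y, f n i (e.toFun y) * edist y e.base ^ t ∂q.toMeasure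
      = ∫⁻ z, H i z ∂((e.embed q).1 : Measure E) := by
    rw [e.lintegral_embed q (H i).continuous.measurable.coe_nnreal_ennreal]
    refine lintegral_congr fun y => ?_
    simp only [H, ContinuousMap.mul_apply, ContinuousMap.coe_mk, ENNReal.coe_mul]
    rcases eq_or_ne (f n i (e.toFun y)) 0 with h | h
    · simp [h]
    · rw [min_eq_left (hR i _ (hsupp h)), e.weight_apply, ENNReal.coe_toNNReal]
      exact (ENNReal.rpow_lt_top_of_nonneg (by linarith) (edist_ne_top _ _)).ne
  have hintf (g : C(E, NNReal)) (q : ProbabilityMeasure E) :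
      ∫⁻ z, g z ∂(q : Measure E) ≠ ∞ := by
    have := (BoundedContinuousFunction.mkOfCompact g).lintegral_lt_top_of_nnreal (q : Measure E)
    exact this.ne
  -- The tail moment of `q` is the total moment minus weakly continuous integrals. This is why the
  -- moment has to be a coordinate of the embedding.
  have hdecomp (q : PSpace Y t) :
      ∫⁻ y, f₀ n (e.toFun y) * edist y e.base ^ t ∂q.toMeasure
        = q.moment e.base - ∑ i ∈ Finset.range n, ∫⁻ z, H i z ∂((e.embed q).1 : Measure E) := by
    refine ENNReal.eq_sub_of_add_eq (ENNReal.sum_ne_top.2 fun i _ => hintf _ _) ?_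
    simp_rw [← hH]
    rw [← lintegral_finsetSum _ fun i _ => by exact (hfm n i).mul hDm,
      ← lintegral_add_left (by exact (hf₀m n).mul hDm)]
    refine lintegral_congr fun y => ?_
    rw [← Finset.sum_mul, ← add_mul]
    have : (f₀ n (e.toFun y) : ℝ≥0∞) + ∑ i ∈ Finset.range n, (f n i (e.toFun y) : ℝ≥0∞) = 1 := by
      exact_mod_cast hsum n (e.toFun y)
    rw [this, one_mul]
  let S : ℝ≥0∞ := ∑ i ∈ Finset.range n, (R i : ℝ≥0∞)
  have hS : S ≠ ∞ := ENNReal.sum_ne_top.2 fun i _ => ENNReal.coe_ne_top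
  let a : ℕ → ProbabilityMeasure E → ℝ≥0∞ := fun i q => ∫⁻ z, f n i z ∂(q : Measure E)
  have ha (i) : Continuous (a i) := ProbabilityMeasure.continuous_lintegral_continuousMap (f n i)
  have hafin (i q) : a i q ≠ ∞ := hintf _ _
  -- The bound of `exists_coupling_cost_le` as a function of the coordinates of `q`. It is
  -- continuous at `e.embed p`, where the mass differences vanish and the value is below `ε ^ t`.
  let B : ProbabilityMeasure E × ℝ≥0∞ → ℝ≥0∞ := fun x =>
    ENNReal.ofReal δ ^ t + 2 ^ (t - 1) *
      ((T n + S * ∑ i ∈ Finset.range n, (a i (e.embed p).1 - a i x.1)) +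
        ((x.2 - ∑ i ∈ Finset.range n, ∫⁻ z, H i z ∂(x.1 : Measure E)) +
          S * ∑ i ∈ Finset.range n, (a i x.1 - a i (e.embed p).1)))
  have hBp : B (e.embed p) = ENNReal.ofReal δ ^ t + 2 ^ (t - 1) * (T n + T n) := by
    have h2 : (e.embed p).2 - ∑ i ∈ Finset.range n, ∫⁻ z, H i z ∂((e.embed p).1 : Measure E)
      = T n := (hdecomp p).symm
    simp only [B, tsub_self, Finset.sum_const_zero, mul_zero, add_zero, h2]
  have hB : ContinuousAt B (e.embed p) := by
    have h2 : (2 : ℝ≥0∞) ^ (t - 1) ≠ ∞ :=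
      (ENNReal.rpow_lt_top_of_nonneg (by linarith) (by simp)).ne
    have ha' (i) : Tendsto (fun x : ProbabilityMeasure E × ℝ≥0∞ => a i x.1) (𝓝 (e.embed p))
      (𝓝 (a i (e.embed p).1)) := ((ha i).comp continuous_fst).tendsto _
    have hH' (i) : Tendsto (fun x : ProbabilityMeasure E × ℝ≥0∞ =>
        ∫⁻ z, H i z ∂(x.1 : Measure E)) (𝓝 (e.embed p))
        (𝓝 (∫⁻ z, H i z ∂((e.embed p).1 : Measure E))) :=
      ((ProbabilityMeasure.continuous_lintegral_continuousMap (H i)).comp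
        continuous_fst).tendsto _
    refine Tendsto.const_add _ (ENNReal.Tendsto.const_mul (Tendsto.add
      (Tendsto.const_add _ (ENNReal.Tendsto.const_mul ?_ (Or.inr hS)))
      (Tendsto.add (ENNReal.Tendsto.sub (continuous_snd.tendsto _)
        (tendsto_finsetSum _ fun i _ => hH' i) (Or.inl hmom.ne))
        (ENNReal.Tendsto.const_mul ?_ (Or.inr hS)))) (Or.inr h2))
    · exact tendsto_finsetSum _ fun i _ =>
        ENNReal.Tendsto.sub tendsto_const_nhds (ha' i) (Or.inl (hafin i _))
    · exact tendsto_finsetSum _ fun i _ =>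
        ENNReal.Tendsto.sub (ha' i) tendsto_const_nhds (Or.inl (hafin i _))
  have hev := hB.eventually_lt_const (hBp ▸ hn)
  obtain ⟨U, hUB, hU, hpU⟩ := mem_nhds_iff.1 hev
  refine ⟨U, hU, hpU, fun q hq => ?_⟩
  have hBq : B (e.embed q) < ε ^ t := hUB hq
  obtain ⟨π, h1, h2, h3⟩ := exists_coupling_cost_le ht e.base p.toMeasure q.toMeasure (n := n)
    (f := fun i y => f n i (e.toFun y)) (f₀ := fun y => f₀ n (e.toFun y))
    (fun i => hfm n i) (hf₀m n) (fun y => by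
      rw [Fin.sum_univ_eq_sum_range (fun i => (f n i (e.toFun y) : ℝ≥0∞))]
      exact_mod_cast hsum n (e.toFun y)) (δ := ENNReal.ofReal δ) (R := S)
    (fun i y y' hy hy' => hdiam i y y' (hsupp (by exact_mod_cast hy))
      (hsupp (by exact_mod_cast hy')))
    (fun i y hy => by
      rw [← e.weight_apply]
      refine (hR i _ (hsupp (by exact_mod_cast hy))).trans ?_
      exact Finset.single_le_sum (f := fun i => (R i : ℝ≥0∞)) (fun _ _ => zero_le)
        (Finset.mem_range.2 i.2))
  refine wasserstein_lt ht π h1 h2 (h3.trans_lt (lt_of_eq_of_lt ?_ hBq))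
  have ha2 (i) (q : PSpace Y t) : ∫⁻ y, f n i (e.toFun y) ∂q.toMeasure = a i (e.embed q).1 :=
    (e.lintegral_embed q (f n i).continuous.measurable.coe_nnreal_ennreal).symm
  simp_rw [ha2, hdecomp q]
  rw [Fin.sum_univ_eq_sum_range (fun i => a i (e.embed p).1 - a i (e.embed q).1),
    Fin.sum_univ_eq_sum_range (fun i => a i (e.embed q).1 - a i (e.embed p).1)]
  rfl

end WassersteinNhds

end WeakTransport

/-! ### Lower semicontinuous extension of the cost. -/

namespace WeakTransport

open Filter Set

section LscHull

/-- A function which is lower semicontinuous for the topology induced by `J` is the restriction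
along `J` of a lower semicontinuous function. -/
theorem exists_lowerSemicontinuous_extension {Z W : Type*} [TopologicalSpace W] (J : Z → W)
    (c : Z → ℝ≥0∞)
    (h : ∀ z, ∀ a < c z, ∃ U : Set W, IsOpen U ∧ J z ∈ U ∧ ∀ z', J z' ∈ U → a < c z') :
    ∃ f : W → ℝ≥0∞, LowerSemicontinuous f ∧ ∀ z, f (J z) = c z := by
  -- The lower semicontinuous hull: the supremum over open neighbourhoods of the infimum of `c` on
  -- them. Away from the closure of the image it is `∞`, an empty infimum.
  refine ⟨fun w => ⨆ (U : Set W) (_ : IsOpen U ∧ w ∈ U), ⨅ (z : Z) (_ : J z ∈ U), c z,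
    fun w a ha => ?_, fun z => le_antisymm ?_ ?_⟩
  · simp only [lt_iSup_iff] at ha
    obtain ⟨U, ⟨hU, hw⟩, ha⟩ := ha
    filter_upwards [hU.mem_nhds hw] with w' hw'
    exact ha.trans_le (le_iSup₂_of_le U ⟨hU, hw'⟩ le_rfl)
  · exact iSup₂_le fun U hU => iInf₂_le z hU.2
  · refine le_of_forall_lt fun a ha => ?_
    obtain ⟨b, hab, hb⟩ := exists_between ha
    obtain ⟨U, hU, hz, hUc⟩ := h z b hb
    exact hab.trans_le (le_iSup₂_of_le U ⟨hU, hz⟩ (le_iInf₂ fun z' hz' => (hUc z' hz').le))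

variable {Y : Type*} [MetricSpace Y] [MeasurableSpace Y] [BorelSpace Y]
  [SecondCountableTopology Y] {t : ℝ}
  {E : Type*} [MetricSpace E] [CompactSpace E] [MeasurableSpace E] [BorelSpace E]
  {X : Type*} [TopologicalSpace X] {F : Type*} [TopologicalSpace F]

/-- A lower semicontinuous cost extends to a lower semicontinuous function on the
compactification of `X × 𝒫ᵗ(Y)`. -/
theorem MomentEmbedding.exists_extension (e : MomentEmbedding Y E t) (ht : 1 ≤ t) {ιX : X → F}
    (hιX : IsEmbedding ιX) (c : X × PSpace Y t → ℝ≥0∞) (hc : LowerSemicontinuous c) :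
    ∃ f : F × (ProbabilityMeasure E × ℝ≥0∞) → ℝ≥0∞, LowerSemicontinuous f ∧
      ∀ x p, f (ιX x, e.embed p) = c (x, p) := by
  obtain ⟨f, hf, hfc⟩ := exists_lowerSemicontinuous_extension
    (fun z : X × PSpace Y t => (ιX z.1, e.embed z.2)) c (by
      rintro ⟨x, p⟩ a ha
      have h := hc (x, p) a ha
      rw [nhds_prod_eq, eventually_prod_iff] at h
      obtain ⟨A, hA, B, hB, hAB⟩ := h
      rw [hιX.nhds_eq_comap, eventually_comap] at hA
      obtain ⟨U, hUA, hU, hxU⟩ := mem_nhds_iff.1 hA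
      obtain ⟨O, hOB, hO, hpO⟩ := mem_nhds_iff.1 hB
      -- Open sets contain balls around their points by definition of the topology, so no metric
      -- axiom for `wasserstein` is needed.
      obtain ⟨ε, hε, hεO⟩ := hO p hpO
      obtain ⟨U', hU', hpU', hW⟩ := e.exists_isOpen_wasserstein_lt ht p hε
      refine ⟨U ×ˢ U', hU.prod hU', ⟨hxU, hpU'⟩, fun z hz => ?_⟩
      exact hAB (hUA hz.1 z.1 rfl) (hOB (hεO _ (hW _ hz.2))))
  exact ⟨f, hf, fun x p => hfc (x, p)⟩

end LscHull

/-! ### Shifting the cost to a nonnegative one. -/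

section EReal

theorem coe_add_toENNReal_sub {K : ℝ} {a : EReal} (h : (K : EReal) ≤ a) :
    (K : EReal) + ((a - K).toENNReal : EReal) = a := by
  rw [EReal.coe_toENNReal (EReal.sub_nonneg (by simp) (by simp) |>.2 h), add_comm,
    EReal.sub_add_cancel]

theorem coe_add_lt_coe_add {K : ℝ} {a b : EReal} : (K : EReal) + a < K + b ↔ a < b := by
  constructor
  · intro h
    by_contra h'
    exact absurd h (not_lt.2 (add_le_add le_rfl (not_lt.1 h')))
  · intro h
    exact EReal.add_lt_add_left_coe h K

theorem coe_add_le_coe_add {K : ℝ} {a b : EReal} : (K : EReal) + a ≤ K + b ↔ a ≤ b := by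
  rw [← not_lt, coe_add_lt_coe_add, not_lt]

theorem lowerSemicontinuous_toENNReal_sub {Z : Type*} [TopologicalSpace Z] {f : Z → EReal}
    (hf : LowerSemicontinuous f) {K : ℝ} (hK : ∀ z, (K : EReal) ≤ f z) :
    LowerSemicontinuous fun z => (f z - K).toENNReal := by
  intro z a ha
  have key (z) : a < (f z - K).toENNReal ↔ (K : EReal) + a < f z := by
    conv_rhs => rw [← coe_add_toENNReal_sub (hK z)]
    rw [coe_add_lt_coe_add, EReal.coe_ennreal_lt_coe_ennreal_iff]
  exact (hf z _ ((key z).1 ha)).mono fun z' hz' => (key z').2 hz'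

end EReal

/-! ### Convexity and finite averages. -/

section Convex

variable {Y : Type*} [MetricSpace Y] [MeasurableSpace Y] [BorelSpace Y]
  [SecondCountableTopology Y] {t : ℝ}

/-- The mixture of two elements of `𝒫ᵗ(Y)`. -/
theorem PSpace.exists_mixture (ht : 1 ≤ t) (p q : PSpace Y t) {a b : ℝ≥0∞} (hab : a + b = 1) :
    ∃ r : PSpace Y t, r.toMeasure = a • p.toMeasure + b • q.toMeasure := by
  obtain ⟨y₀, hy₀⟩ := p.finite_moment
  have hprob : IsProbabilityMeasure (a • p.toMeasure + b • q.toMeasure) := ⟨by simp [hab]⟩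
  have ha : a ≠ ∞ := ne_top_of_le_ne_top ENNReal.one_ne_top (hab ▸ le_self_add)
  have hb : b ≠ ∞ := ne_top_of_le_ne_top ENNReal.one_ne_top (hab ▸ le_add_self)
  refine ⟨⟨⟨_, hprob⟩, y₀, ?_⟩, rfl⟩
  change ∫⁻ y, edist y y₀ ^ t ∂(a • p.toMeasure + b • q.toMeasure) < ∞
  rw [lintegral_add_measure, lintegral_smul_measure, lintegral_smul_measure]
  exact ENNReal.add_lt_top.2 ⟨ENNReal.mul_lt_top ha.lt_top hy₀,
    ENNReal.mul_lt_top hb.lt_top (q.moment_lt_top ht y₀)⟩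

/-- Convexity of a `[0, ∞]`-valued function on `𝒫ᵗ(Y)`. -/
def ConvexENNReal (h : PSpace Y t → ℝ≥0∞) : Prop :=
  ∀ (p q r : PSpace Y t) (a b : ℝ≥0∞), a + b = 1 →
    r.toMeasure = a • p.toMeasure + b • q.toMeasure → h r ≤ a * h p + b * h q

/-- The weights sum to one, so the constant `K` splits as `a K + b K` and cancels from both sides.
-/
theorem ConvexOnPSpace.toENNReal_sub {G : PSpace Y t → EReal} (hG : ConvexOnPSpace G) {K : ℝ}
    (hK : ∀ p, (K : EReal) ≤ G p) : ConvexENNReal fun p => (G p - K).toENNReal := by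
  intro p q r a b hab hr
  have ha : a ≠ ∞ := ne_top_of_le_ne_top ENNReal.one_ne_top (hab ▸ le_self_add)
  have hb : b ≠ ∞ := ne_top_of_le_ne_top ENNReal.one_ne_top (hab ▸ le_add_self)
  have hab' : b.toReal = 1 - a.toReal := by
    have := congrArg ENNReal.toReal hab
    rw [ENNReal.toReal_add ha hb, ENNReal.toReal_one] at this
    linarith
  have h := hG p q r a.toReal ENNReal.toReal_nonneg
    (by linarith [ENNReal.toReal_nonneg (a := b)])
    (by rw [← hab', ENNReal.ofReal_toReal ha, ENNReal.ofReal_toReal hb, hr])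
  have ha' : (a.toReal : EReal) = a := EReal.coe_ennreal_toReal ha
  have hb' : (b.toReal : EReal) = b := EReal.coe_ennreal_toReal hb
  have hK' : (a.toReal : EReal) * K + (b.toReal : EReal) * K = K := by
    rw [← EReal.coe_mul, ← EReal.coe_mul, ← EReal.coe_add, ← add_mul, hab',
      add_sub_cancel, one_mul]
  rw [← hab', ← coe_add_toENNReal_sub (hK p), ← coe_add_toENNReal_sub (hK q),
    ← coe_add_toENNReal_sub (hK r),
    EReal.left_distrib_of_nonneg_of_ne_top (EReal.coe_nonneg.2 ENNReal.toReal_nonneg) (by simp),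
    EReal.left_distrib_of_nonneg_of_ne_top (EReal.coe_nonneg.2 ENNReal.toReal_nonneg) (by simp),
    add_add_add_comm, hK', coe_add_le_coe_add, ha', hb', ← EReal.coe_ennreal_mul,
    ← EReal.coe_ennreal_mul, ← EReal.coe_ennreal_add, EReal.coe_ennreal_le_coe_ennreal_iff] at h
  exact h

/-- Jensen's inequality for uniform averages. -/
theorem ConvexENNReal.exists_average (ht : 1 ≤ t) {h : PSpace Y t → ℝ≥0∞} (hh : ConvexENNReal h)
    (p : ℕ → PSpace Y t) (n : ℕ) :
    ∃ r : PSpace Y t,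
      r.toMeasure = ((n : ℝ≥0∞) + 1)⁻¹ • ∑ i ∈ Finset.range (n + 1), (p i).toMeasure ∧
      h r ≤ ((n : ℝ≥0∞) + 1)⁻¹ * ∑ i ∈ Finset.range (n + 1), h (p i) := by
  induction n with
  | zero => exact ⟨p 0, by simp, by simp⟩
  | succ n ih =>
    obtain ⟨r, hr, hhr⟩ := ih
    have h0 : (n : ℝ≥0∞) + 1 ≠ 0 := by simp
    have h1 : (n : ℝ≥0∞) + 1 ≠ ∞ := by simp
    have h2 : ((n + 1 : ℕ) : ℝ≥0∞) + 1 ≠ 0 := by simp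
    have h3 : ((n + 1 : ℕ) : ℝ≥0∞) + 1 ≠ ∞ := by
      exact ENNReal.add_ne_top.2 ⟨ENNReal.natCast_ne_top _, ENNReal.one_ne_top⟩
    set b : ℝ≥0∞ := (((n + 1 : ℕ) : ℝ≥0∞) + 1)⁻¹ with hb
    have hab : b * ((n : ℝ≥0∞) + 1) + b = 1 := by
      have : (n : ℝ≥0∞) + 1 + 1 = ((n + 1 : ℕ) : ℝ≥0∞) + 1 := by push_cast; rfl
      rw [← mul_add_one, this, hb, ENNReal.inv_mul_cancel h2 h3]
    obtain ⟨s, hs⟩ := PSpace.exists_mixture ht r (p (n + 1)) hab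
    refine ⟨s, ?_, ?_⟩
    · rw [hs, hr, smul_smul, mul_assoc, ENNReal.mul_inv_cancel h0 h1, mul_one,
        Finset.sum_range_succ _ (n + 1), smul_add]
    · calc h s ≤ b * ((n : ℝ≥0∞) + 1) * h r + b * h (p (n + 1)) := hh _ _ _ _ _ hab hs
        _ ≤ b * ((n : ℝ≥0∞) + 1) * (((n : ℝ≥0∞) + 1)⁻¹ * ∑ i ∈ Finset.range (n + 1), h (p i))
            + b * h (p (n + 1)) := by gcongr
        _ = _ := by
          rw [← mul_assoc, mul_assoc b, ENNReal.mul_inv_cancel h0 h1, mul_one,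
            Finset.sum_range_succ _ (n + 1), mul_add]

end Convex
end WeakTransport

/-! ### Jensen's inequality from the strong law of large numbers. -/

namespace WeakTransport

open Filter Set ProbabilityTheory

section StrongLaw

variable {N : Type*} [MeasurableSpace N] (ρ : Measure N) [IsProbabilityMeasure ρ]

theorem strong_law_infinitePi {f : N → ℝ} (hfm : Measurable f) (hf : Integrable f ρ) :
    ∀ᵐ ω ∂Measure.infinitePi (fun _ : ℕ => ρ),
      Tendsto (fun n : ℕ => ((n : ℝ) + 1)⁻¹ * ∑ i ∈ Finset.range (n + 1), f (ω i)) atTop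
        (𝓝 (∫ x, f x ∂ρ)) := by
  have hmp (i : ℕ) : MeasurePreserving (fun ω : ℕ → N => ω i) (Measure.infinitePi fun _ => ρ) ρ :=
    measurePreserving_eval_infinitePi (fun _ => ρ) i
  have hind := iIndepFun_infinitePi (P := fun _ : ℕ => ρ) (X := fun _ => f) fun _ => hfm
  have hsl := strong_law_ae_real (μ := Measure.infinitePi fun _ : ℕ => ρ) (fun i ω => f (ω i))
    ((hmp 0).integrable_comp_of_integrable hf) (fun i j hij => hind.indepFun hij)
    (fun i => ⟨(hfm.comp (measurable_pi_apply i)).aemeasurable,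
      (hfm.comp (measurable_pi_apply 0)).aemeasurable, by
        have h (k : ℕ) : Measure.map (fun ω : ℕ → N => f (ω k)) (Measure.infinitePi fun _ => ρ)
            = ρ.map f := by
          conv_rhs => rw [← (hmp k).map_eq]
          exact (Measure.map_map hfm (measurable_pi_apply k)).symm
        rw [h i, h 0]⟩)
  have hint : ∫ ω, f (ω 0) ∂(Measure.infinitePi fun _ : ℕ => ρ) = ∫ x, f x ∂ρ := by
    conv_rhs => rw [← (hmp 0).map_eq]
    exact (integral_map (measurable_pi_apply 0).aemeasurable hfm.aestronglyMeasurable).symm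
  filter_upwards [hsl] with ω hω
  rw [hint] at hω
  refine ((tendsto_add_atTop_iff_nat 1).2 hω).congr fun n => ?_
  rw [div_eq_inv_mul]
  push_cast
  rfl

theorem strong_law_infinitePi_lintegral {g : N → ℝ≥0∞} (hgm : Measurable g)
    (hg : ∫⁻ x, g x ∂ρ ≠ ∞) :
    ∀ᵐ ω ∂Measure.infinitePi (fun _ : ℕ => ρ),
      Tendsto (fun n : ℕ => ((n : ℝ≥0∞) + 1)⁻¹ * ∑ i ∈ Finset.range (n + 1), g (ω i)) atTop
        (𝓝 (∫⁻ x, g x ∂ρ)) := by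
  have hfin : ∀ᵐ x ∂ρ, g x ≠ ∞ := by
    filter_upwards [ae_lt_top hgm hg] with x hx using hx.ne
  have hfin' : ∀ᵐ ω ∂Measure.infinitePi (fun _ : ℕ => ρ), ∀ i, g (ω i) ≠ ∞ :=
    ae_all_iff.2 fun i =>
      (measurePreserving_eval_infinitePi (fun _ : ℕ => ρ) i).quasiMeasurePreserving.ae hfin
  filter_upwards [hfin', strong_law_infinitePi ρ hgm.ennreal_toReal
    (integrable_toReal_of_lintegral_ne_top hgm.aemeasurable hg)] with ω h1 h2
  rw [integral_toReal hgm.aemeasurable (hfin.mono fun x hx => hx.lt_top)] at h2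
  have h3 := (ENNReal.continuous_ofReal.tendsto _).comp h2
  rw [ENNReal.ofReal_toReal hg] at h3
  refine h3.congr fun n => ?_
  simp only [Function.comp_apply]
  rw [ENNReal.ofReal_mul (by positivity), ENNReal.ofReal_inv_of_pos (by positivity),
    ENNReal.ofReal_add (by positivity) zero_le_one, ENNReal.ofReal_natCast, ENNReal.ofReal_one,
    ENNReal.ofReal_sum_of_nonneg fun i _ => ENNReal.toReal_nonneg]
  simp_rw [ENNReal.ofReal_toReal (h1 _)]

end StrongLaw

theorem integral_bind {α β : Type*} [MeasurableSpace α] [MeasurableSpace β] (κ : Kernel α β)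
    [IsSFiniteKernel κ] (m : Measure α) [SFinite m] {f : β → ℝ} (hf : Integrable f (m.bind κ)) :
    ∫ y, f y ∂(m.bind κ) = ∫ x, ∫ y, f y ∂κ x ∂m := by
  rw [Measure.comp_eq_comp_const_apply] at hf ⊢
  rw [Kernel.integral_comp hf, Kernel.const_apply]

section Jensen

variable {Y : Type*} [MetricSpace Y] [PolishSpace Y] [MeasurableSpace Y] [BorelSpace Y] {t : ℝ}
  {E : Type*} [MetricSpace E] [CompactSpace E] [MeasurableSpace E] [BorelSpace E]

/-- A continuous injection of a Polish space maps Borel sets to Borel sets. Hence measures on `E`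
carried by the image of `Y` pull back to `Y`. -/
theorem MomentEmbedding.measurableEmbedding (e : MomentEmbedding Y E t) :
    MeasurableEmbedding e.toFun :=
  e.isEmbedding.continuous.measurableEmbedding e.isEmbedding.injective

/-- The kernel `(q, s) ↦ q`. -/
noncomputable def evalKernel (E : Type*) [MeasurableSpace E] :
    Kernel (ProbabilityMeasure E × ℝ≥0∞) E :=
  ⟨fun n => (n.1 : Measure E), measurable_subtype_coe.comp measurable_fst⟩

instance : IsMarkovKernel (evalKernel E) :=
  ⟨fun n => inferInstanceAs (IsProbabilityMeasure (n.1 : Measure E))⟩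

theorem evalKernel_apply (n : ProbabilityMeasure E × ℝ≥0∞) :
    evalKernel E n = (n.1 : Measure E) := rfl

theorem MomentEmbedding.exists_pspace_map_eq (e : MomentEmbedding Y E t) (m : Measure E)
    [IsProbabilityMeasure m] (hm : m (range e.toFun)ᶜ = 0) (hw : ∫⁻ z, e.weight z ∂m < ∞) :
    ∃ p : PSpace Y t, p.toMeasure.map e.toFun = m := by
  have hmap : (m.comap e.toFun).map e.toFun = m := by
    rw [e.measurableEmbedding.map_comap, Measure.restrict_eq_self_of_ae_mem]
    exact hm
  have hprob : IsProbabilityMeasure (m.comap e.toFun) := by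
    constructor
    have := congrArg (fun m : Measure E => m univ) hmap
    simp only [Measure.map_apply e.measurable MeasurableSet.univ, preimage_univ, measure_univ]
      at this
    exact this
  refine ⟨⟨⟨m.comap e.toFun, hprob⟩, e.base, ?_⟩, hmap⟩
  rw [← hmap, lintegral_map e.continuous_weight.measurable e.measurable] at hw
  simpa [e.weight_apply] using hw

/-- Jensen's inequality for a convex lower semicontinuous function on `𝒫ᵗ(Y)`. -/
theorem ConvexENNReal.jensen (e : MomentEmbedding Y E t) (ht : 1 ≤ t)
    (ρ : Measure (ProbabilityMeasure E × ℝ≥0∞)) [IsProbabilityMeasure ρ]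
    (hρ : ∀ᵐ n ∂ρ, n ∈ range e.embed) (hs : ∫⁻ n, n.2 ∂ρ < ∞)
    {h : PSpace Y t → ℝ≥0∞} (hh : ConvexENNReal h)
    {H : ProbabilityMeasure E × ℝ≥0∞ → ℝ≥0∞} (hH : LowerSemicontinuous H)
    (hHh : ∀ p, H (e.embed p) = h p) :
    ∃ p : PSpace Y t, p.toMeasure.map e.toFun = ρ.bind (evalKernel E) ∧
      h p ≤ ∫⁻ n, H n ∂ρ := by
  have hwm : Measurable e.weight := e.continuous_weight.measurable
  have hwbind : ∫⁻ z, e.weight z ∂(ρ.bind (evalKernel E)) = ∫⁻ n, n.2 ∂ρ := by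
    rw [Measure.lintegral_bind (evalKernel E).aemeasurable hwm.aemeasurable]
    refine lintegral_congr_ae ?_
    filter_upwards [hρ] with n hn
    obtain ⟨p, rfl⟩ := hn
    exact e.lintegral_weight p
  obtain ⟨p, hp⟩ := e.exists_pspace_map_eq (ρ.bind (evalKernel E)) (by
    rw [Measure.bind_apply e.measurableEmbedding.measurableSet_range.compl
      (evalKernel E).aemeasurable, lintegral_eq_zero_iff' (by
        exact ((evalKernel E).measurable_coe
          e.measurableEmbedding.measurableSet_range.compl).aemeasurable)]
    filter_upwards [hρ] with n hn
    obtain ⟨p, rfl⟩ := hn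
    rw [evalKernel_apply, e.embed_fst, Measure.map_apply e.measurable
      e.measurableEmbedding.measurableSet_range.compl]
    simp) (hwbind ▸ hs)
  refine ⟨p, hp, ?_⟩
  have hHm : Measurable H := hH.measurable
  rcases eq_or_ne (∫⁻ n, H n ∂ρ) ∞ with htop | htop
  · rw [htop]; exact le_top
  have hGm (j) : Measurable fun n : ProbabilityMeasure E × ℝ≥0∞ =>
      ∫ z, denseTest E j z ∂(n.1 : Measure E) :=
    (measurable_integral_probabilityMeasure (denseTest E j).continuous.measurable).comp
      measurable_fst
  have hG (j) : Integrable (fun n : ProbabilityMeasure E × ℝ≥0∞ =>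
      ∫ z, denseTest E j z ∂(n.1 : Measure E)) ρ := by
    refine Integrable.of_bound (hGm j).aestronglyMeasurable ‖denseTest E j‖ (ae_of_all _ fun n => ?_)
    have := norm_integral_le_of_norm_le_const (μ := (n.1 : Measure E))
      (ae_of_all _ fun z => (denseTest E j).norm_coe_le_norm z)
    simpa using this
  have hall : ∀ᵐ ω ∂Measure.infinitePi (fun _ : ℕ => ρ), ∀ i, ω i ∈ range e.embed :=
    ae_all_iff.2 fun i =>
      (measurePreserving_eval_infinitePi (fun _ : ℕ => ρ) i).quasiMeasurePreserving.ae hρ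
  -- Almost every i.i.d. sample from `ρ` obeys the strong law for the moment, for `H` and for all
  -- test functions at once; one such sample is fixed. Its empirical averages converge to the
  -- barycentre `p`, and finite convexity plus lower semicontinuity of `H` give the inequality.
  obtain ⟨ω, hω, hωs, hωH, hωG⟩ := (hall.and ((strong_law_infinitePi_lintegral ρ measurable_snd
    hs.ne).and ((strong_law_infinitePi_lintegral ρ hHm htop).and
      (ae_all_iff.2 fun j => strong_law_infinitePi ρ (hGm j) (hG j))))).exists
  choose q hq using hω
  choose r hr hhr using fun n => hh.exists_average ht q n
  have hlim : Tendsto (fun n => e.embed (r n)) atTop (𝓝 (e.embed p)) := by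
    refine Tendsto.prodMk_nhds ?_ ?_
    · refine tendsto_of_forall_denseTest fun j => ?_
      have h1 : ∫ n, ∫ z, denseTest E j z ∂(n.1 : Measure E) ∂ρ
          = ∫ z, denseTest E j z ∂((e.embed p).1 : Measure E) := by
        rw [e.embed_fst, hp]
        exact (integral_bind (evalKernel E) ρ (integrable_continuousMap (denseTest E j) _)).symm
      change Tendsto (fun i => ∫ x, denseTest E j x ∂((e.embed (r i)).1 : Measure E)) atTop
        (𝓝 (∫ x, denseTest E j x ∂((e.embed p).1 : Measure E)))
      rw [← h1]
      refine (hωG j).congr fun n => ?_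
      have h2 : ((e.embed (r n)).1 : Measure E)
          = ((n : ℝ≥0∞) + 1)⁻¹ • ∑ i ∈ Finset.range (n + 1), ((ω i).1 : Measure E) := by
        rw [e.embed_fst, hr, Measure.map_smul, map_finsetSum_measure _ e.measurable]
        simp_rw [← hq, e.embed_fst]
      rw [h2, integral_smul_measure, integral_finsetSum_measure fun i _ =>
        integrable_continuousMap (denseTest E j) _, ENNReal.toReal_inv, smul_eq_mul,
        ENNReal.toReal_add (ENNReal.natCast_ne_top n) ENNReal.one_ne_top, ENNReal.toReal_natCast,
        ENNReal.toReal_one]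
    · have h1 : p.moment e.base = ∫⁻ n, n.2 ∂ρ := by
        rw [← hwbind, ← hp]
        exact (e.lintegral_weight p).symm
      rw [h1]
      refine hωs.congr fun n => ?_
      change _ = ∫⁻ y, edist y e.base ^ t ∂(r n).toMeasure
      rw [hr, lintegral_smul_measure, lintegral_finsetSum_measure, smul_eq_mul]
      simp_rw [← hq]
      rfl
  have hle : H (e.embed p) ≤ liminf (fun n => H (e.embed (r n))) atTop :=
    (hH.le_liminf _).trans (hlim.liminf_le_liminf_comp ..)
  rw [← hHh]
  refine hle.trans ?_
  rw [← hωH.liminf_eq]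
  refine liminf_le_liminf (Eventually.of_forall fun n => ?_)
  simp_rw [hHh, ← hq, hHh]
  exact hhr n

end Jensen
end WeakTransport

/-! ### Compactness, and passage from limits to couplings. -/

namespace WeakTransport

open Filter Set ProbabilityTheory

section Limit

variable {X : Type*} [TopologicalSpace X] [PolishSpace X] [MeasurableSpace X] [BorelSpace X]
  {Y : Type*} [MetricSpace Y] [PolishSpace Y] [MeasurableSpace Y] [BorelSpace Y] {t : ℝ}
  {E : Type*} [MetricSpace E] [CompactSpace E] [MeasurableSpace E] [BorelSpace E]
  {F : Type*} [MetricSpace F] [CompactSpace F] [MeasurableSpace F] [BorelSpace F]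

/-- The left side is weakly lower semicontinuous, so the inequality survives limits; the
corresponding equality need not. -/
theorem isClosed_lintegral_le {g : E → ℝ≥0∞} (hg : LowerSemicontinuous g) :
    IsClosed {n : ProbabilityMeasure E × ℝ≥0∞ | ∫⁻ z, g z ∂(n.1 : Measure E) ≤ n.2} := by
  refine IsSeqClosed.isClosed fun u n hu hn => ?_
  have h1 := lintegral_le_liminf_of_lowerSemicontinuous hg
    ((continuous_fst.tendsto n).comp hn)
  have h2 := (continuous_snd.tendsto n).comp hn
  refine h1.trans ?_
  rw [← h2.liminf_eq]
  exact liminf_le_liminf (Eventually.of_forall hu)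

theorem lintegral_le_of_tendsto {W : Type*} [TopologicalSpace W] [CompactSpace W]
    [TopologicalSpace.MetrizableSpace W] [MeasurableSpace W] [BorelSpace W]
    {g : W → ℝ≥0∞} (hg : LowerSemicontinuous g) {P : ℕ → ProbabilityMeasure W}
    {Q : ProbabilityMeasure W} (h : Tendsto P atTop (𝓝 Q)) {b : ℕ → ℝ≥0∞} {a : ℝ≥0∞}
    (hb : Tendsto b atTop (𝓝 a)) (hP : ∀ n, ∫⁻ w, g w ∂(P n : Measure W) ≤ b n) :
    ∫⁻ w, g w ∂(Q : Measure W) ≤ a := by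
  refine (lintegral_le_liminf_of_lowerSemicontinuous hg h).trans ?_
  rw [← hb.liminf_eq]
  exact liminf_le_liminf (Eventually.of_forall hP)

theorem ae_mem_of_tendsto {W : Type*} [TopologicalSpace W] [CompactSpace W]
    [TopologicalSpace.MetrizableSpace W] [MeasurableSpace W] [BorelSpace W]
    {A : Set W} (hA : IsClosed A) {P : ℕ → ProbabilityMeasure W}
    {Q : ProbabilityMeasure W} (h : Tendsto P atTop (𝓝 Q))
    (hP : ∀ n, ∀ᵐ w ∂(P n : Measure W), w ∈ A) : ∀ᵐ w ∂(Q : Measure W), w ∈ A := by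
  let := TopologicalSpace.metrizableSpaceMetric W
  have h1 := ProbabilityMeasure.le_liminf_measure_open_of_tendsto h hA.isOpen_compl
  have h2 (n) : (P n : Measure W) Aᶜ = 0 := hP n
  simp_rw [h2, liminf_const] at h1
  exact le_antisymm h1 zero_le

theorem MomentEmbedding.exists_embed_eq (e : MomentEmbedding Y E t)
    (n : ProbabilityMeasure E × ℝ≥0∞) (h0 : (n.1 : Measure E) (range e.toFun)ᶜ = 0)
    (h1 : ∫⁻ z, e.weight z ∂(n.1 : Measure E) = n.2) (h2 : n.2 < ∞) : n ∈ range e.embed := by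
  obtain ⟨p, hp⟩ := e.exists_pspace_map_eq (n.1 : Measure E) h0 (h1 ▸ h2)
  refine ⟨p, Prod.ext (Subtype.ext hp) ?_⟩
  rw [← h1, ← hp]
  exact (e.lintegral_weight p).symm

/-- A sequence of probability measures on the compactification of `X × 𝒫ᵗ(Y)` whose marginals and
moments converge has a limit point that is carried by `X × 𝒫ᵗ(Y)`. -/
theorem MomentEmbedding.exists_limit (e : MomentEmbedding Y E t) (ht : 1 ≤ t) {ιX : X → F}
    (hιX : IsEmbedding ιX) {f : F × (ProbabilityMeasure E × ℝ≥0∞) → ℝ≥0∞}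
    (hf : LowerSemicontinuous f) (μ : ProbabilityMeasure X) (ν : PSpace Y t)
    (P : ℕ → ProbabilityMeasure (F × (ProbabilityMeasure E × ℝ≥0∞)))
    (hP : ∀ n, ∀ᵐ w ∂(P n : Measure (F × (ProbabilityMeasure E × ℝ≥0∞))),
      ∫⁻ z, e.weight z ∂(w.2.1 : Measure E) ≤ w.2.2)
    (hPF : ∀ j, Tendsto (fun n => ∫ w, denseTest F j w.1
      ∂(P n : Measure (F × (ProbabilityMeasure E × ℝ≥0∞)))) atTop
      (𝓝 (∫ x, denseTest F j (ιX x) ∂(μ : Measure X))))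
    (hPE : ∀ j, Tendsto (fun n => ∫ w, ∫ z, denseTest E j z ∂(w.2.1 : Measure E)
      ∂(P n : Measure (F × (ProbabilityMeasure E × ℝ≥0∞)))) atTop
      (𝓝 (∫ y, denseTest E j (e.toFun y) ∂ν.toMeasure)))
    {b b' : ℕ → ℝ≥0∞} {m : ℝ≥0∞} (hb : Tendsto b atTop (𝓝 (ν.moment e.base)))
    (hb' : Tendsto b' atTop (𝓝 m))
    (hPb : ∀ n, ∫⁻ w, w.2.2 ∂(P n : Measure (F × (ProbabilityMeasure E × ℝ≥0∞))) ≤ b n)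
    (hPb' : ∀ n, ∫⁻ w, f w ∂(P n : Measure (F × (ProbabilityMeasure E × ℝ≥0∞))) ≤ b' n) :
    ∃ Q : Measure (F × (ProbabilityMeasure E × ℝ≥0∞)), IsProbabilityMeasure Q ∧
      Q.fst = (μ : Measure X).map ιX ∧ Q.snd.bind (evalKernel E) = ν.toMeasure.map e.toFun ∧
      (∀ᵐ w ∂Q, w.2 ∈ range e.embed) ∧ ∫⁻ w, w.2.2 ∂Q < ∞ ∧ ∫⁻ w, f w ∂Q ≤ m := by
  obtain ⟨Q, φ, hφ, hQ⟩ := CompactSpace.tendsto_subseq P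
  have hwm : Measurable e.weight := e.continuous_weight.measurable
  have hιm : Measurable ιX := hιX.continuous.measurable
  have hcont (g : C(F × (ProbabilityMeasure E × ℝ≥0∞), ℝ)) : Tendsto (fun n => ∫ w, g w
      ∂(P (φ n) : Measure (F × (ProbabilityMeasure E × ℝ≥0∞)))) atTop
      (𝓝 (∫ w, g w ∂(Q : Measure (F × (ProbabilityMeasure E × ℝ≥0∞))))) :=
    ((ProbabilityMeasure.continuous_integral_continuousMap g).tendsto Q).comp hQ
  set Q' : Measure (F × (ProbabilityMeasure E × ℝ≥0∞)) :=
    (Q : Measure (F × (ProbabilityMeasure E × ℝ≥0∞))) with hQ'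
  have hfst : Q'.fst = (μ : Measure X).map ιX := by
    have : Q.map (f := Prod.fst) measurable_fst.aemeasurable = μ.map hιm.aemeasurable := by
      refine eq_of_forall_denseTest fun j => ?_
      rw [ProbabilityMeasure.toMeasure_map, ProbabilityMeasure.toMeasure_map,
        integral_map measurable_fst.aemeasurable
          (denseTest F j).continuous.measurable.aestronglyMeasurable,
        integral_map hιm.aemeasurable (denseTest F j).continuous.measurable.aestronglyMeasurable]
      exact tendsto_nhds_unique (hcont ((denseTest F j).comp ⟨Prod.fst, continuous_fst⟩))
        ((hPF j).comp hφ.tendsto_atTop)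
    exact congrArg Subtype.val this
  have hbind : Q'.snd.bind (evalKernel E) = ν.toMeasure.map e.toFun := by
    have : (⟨Q'.snd.bind (evalKernel E), inferInstance⟩ : ProbabilityMeasure E)
        = ν.toProb.map e.measurable.aemeasurable := by
      refine eq_of_forall_denseTest fun j => ?_
      have hjc : Continuous fun n : ProbabilityMeasure E × ℝ≥0∞ =>
          ∫ z, denseTest E j z ∂(n.1 : Measure E) :=
        (ProbabilityMeasure.continuous_integral_continuousMap (denseTest E j)).comp continuous_fst
      rw [ProbabilityMeasure.toMeasure_map,
        integral_map e.measurable.aemeasurable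
          (denseTest E j).continuous.measurable.aestronglyMeasurable]
      refine (integral_bind (evalKernel E) Q'.snd (integrable_continuousMap _ _)).trans ?_
      rw [Measure.snd, integral_map measurable_snd.aemeasurable
        (by exact hjc.measurable.aestronglyMeasurable)]
      exact tendsto_nhds_unique (hcont ⟨_, hjc.comp continuous_snd⟩)
        ((hPE j).comp hφ.tendsto_atTop)
    exact congrArg Subtype.val this
  have hmom : ∫⁻ w, w.2.2 ∂Q' ≤ ν.moment e.base :=
    lintegral_le_of_tendsto (continuous_snd.comp continuous_snd).lowerSemicontinuous hQ
      (hb.comp hφ.tendsto_atTop) fun n => hPb (φ n)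
  have hcost : ∫⁻ w, f w ∂Q' ≤ m :=
    lintegral_le_of_tendsto hf hQ (hb'.comp hφ.tendsto_atTop) fun n => hPb' (φ n)
  have hνfin := ν.moment_lt_top ht e.base
  have hle : ∀ᵐ w ∂Q', ∫⁻ z, e.weight z ∂(w.2.1 : Measure E) ≤ w.2.2 := by
    exact ae_mem_of_tendsto
      ((isClosed_lintegral_le e.continuous_weight.lowerSemicontinuous).preimage continuous_snd)
      hQ fun n => hP (φ n)
  have hwm' : Measurable fun n : ProbabilityMeasure E × ℝ≥0∞ =>
      ∫⁻ z, e.weight z ∂(n.1 : Measure E) :=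
    (measurable_lintegral_probabilityMeasure hwm).comp measurable_fst
  have hwint : ∫⁻ w, ∫⁻ z, e.weight z ∂(w.2.1 : Measure E) ∂Q' = ν.moment e.base := by
    rw [← e.lintegral_weight ν, e.embed_fst, ← hbind,
      Measure.lintegral_bind (evalKernel E).aemeasurable hwm.aemeasurable, Measure.snd,
      lintegral_map (by exact hwm') measurable_snd]
    rfl
  -- The pointwise inequality `hle` is an equality because the integrals are ordered the other way
  -- and finite. No moment escapes in the limit.
  have heq : ∀ᵐ w ∂Q', ∫⁻ z, e.weight z ∂(w.2.1 : Measure E) = w.2.2 :=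
    ae_eq_of_ae_le_of_lintegral_le hle (hwint ▸ hνfin.ne)
      (measurable_snd.comp measurable_snd).aemeasurable (hwint ▸ hmom)
  have hfin : ∀ᵐ w ∂Q', w.2.2 < ∞ :=
    ae_lt_top (measurable_snd.comp measurable_snd) (hmom.trans_lt hνfin).ne
  have hrm := e.measurableEmbedding.measurableSet_range.compl
  have hnull : ∀ᵐ w ∂Q', (w.2.1 : Measure E) (range e.toFun)ᶜ = 0 := by
    have h0 : Q'.snd.bind (evalKernel E) (range e.toFun)ᶜ = 0 := by
      rw [hbind, Measure.map_apply e.measurable hrm]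
      simp
    have hm' : Measurable fun n : ProbabilityMeasure E × ℝ≥0∞ =>
        evalKernel E n (range e.toFun)ᶜ := (evalKernel E).measurable_coe hrm
    rw [Measure.bind_apply hrm (evalKernel E).aemeasurable, Measure.snd,
      lintegral_map hm' measurable_snd, lintegral_eq_zero_iff (by exact hm'.comp measurable_snd)] at h0
    exact h0
  refine ⟨Q', inferInstance, hfst, hbind, ?_, hmom.trans_lt hνfin, hcost⟩
  filter_upwards [heq, hfin, hnull] with w h1 h2 h3
  exact e.exists_embed_eq w.2 h3 h1 h2

/-- A probability measure on the compactification of `X × 𝒫ᵗ(Y)` which is carried by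
`X × 𝒫ᵗ(Y)` induces a coupling of no larger cost, for costs that are convex in the second
argument. -/
theorem MomentEmbedding.exists_coupling (e : MomentEmbedding Y E t) (ht : 1 ≤ t) {ιX : X → F}
    (hιX : IsEmbedding ιX) {f : F × (ProbabilityMeasure E × ℝ≥0∞) → ℝ≥0∞}
    (hf : LowerSemicontinuous f) {c : X → PSpace Y t → ℝ≥0∞}
    (hfc : ∀ x p, f (ιX x, e.embed p) = c x p) (hc : ∀ x, ConvexENNReal (c x))
    (μ : ProbabilityMeasure X) (ν : PSpace Y t)
    (Q : Measure (F × (ProbabilityMeasure E × ℝ≥0∞))) [IsProbabilityMeasure Q]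
    (hQ1 : Q.fst = (μ : Measure X).map ιX)
    (hQ2 : Q.snd.bind (evalKernel E) = ν.toMeasure.map e.toFun)
    (hQ : ∀ᵐ w ∂Q, w.2 ∈ range e.embed) (hQm : ∫⁻ w, w.2.2 ∂Q < ∞) [Nonempty Y] :
    ∃ π ∈ couplings μ ν.toProb, ∃ κ : X → PSpace Y t,
      (∀ᵐ x ∂(μ : Measure X), (κ x).toMeasure = (π : Measure (X × Y)).condKernel x) ∧
      ∫⁻ x, c x (κ x) ∂(μ : Measure X) ≤ ∫⁻ w, f w ∂Q := by
  have hιm : Measurable ιX := hιX.continuous.measurable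
  have hιe := e.measurableEmbedding
  have : Nonempty (ProbabilityMeasure E × ℝ≥0∞) := ⟨e.embed ν⟩
  set Λ : Kernel X (ProbabilityMeasure E × ℝ≥0∞) := Q.condKernel.comap ιX hιm with hΛ
  have hdis : Q = ((μ : Measure X).map ιX) ⊗ₘ Q.condKernel := by
    conv_lhs => rw [← Q.disintegrate Q.condKernel, hQ1]
  have hlint {g : F × (ProbabilityMeasure E × ℝ≥0∞) → ℝ≥0∞} (hg : Measurable g) :
      ∫⁻ w, g w ∂Q = ∫⁻ x, ∫⁻ n, g (ιX x, n) ∂Λ x ∂(μ : Measure X) := by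
    conv_lhs => rw [hdis]
    rw [Measure.lintegral_compProd hg, lintegral_map (hg.lintegral_kernel_prod_right') hιm]
    rfl
  have hae : ∀ᵐ x ∂(μ : Measure X), ∀ᵐ n ∂Λ x, n ∈ range e.embed := by
    rw [hdis] at hQ
    exact ae_of_ae_map hιm.aemeasurable (Measure.ae_ae_of_ae_compProd hQ)
  have hfin : ∀ᵐ x ∂(μ : Measure X), ∫⁻ n, n.2 ∂Λ x < ∞ := by
    rw [hlint (g := fun w => w.2.2) (measurable_snd.comp measurable_snd)] at hQm
    exact ae_lt_top measurable_snd.lintegral_kernel hQm.ne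
  have hjensen : ∀ᵐ x ∂(μ : Measure X), ∃ p : PSpace Y t,
      p.toMeasure.map e.toFun = (Λ x).bind (evalKernel E) ∧
      c x p ≤ ∫⁻ n, f (ιX x, n) ∂Λ x := by
    filter_upwards [hae, hfin] with x h1 h2
    exact (hc x).jensen e ht (Λ x) h1 h2 (hf.comp (Continuous.prodMk_right (ιX x))) (hfc x)
  -- A total choice: on the exceptional null set the value is irrelevant, and `ν` serves as default.
  have hjensen' : ∀ x, ∃ p : PSpace Y t, (∃ p : PSpace Y t,
      p.toMeasure.map e.toFun = (Λ x).bind (evalKernel E) ∧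
      c x p ≤ ∫⁻ n, f (ιX x, n) ∂Λ x) → p.toMeasure.map e.toFun = (Λ x).bind (evalKernel E) ∧
      c x p ≤ ∫⁻ n, f (ιX x, n) ∂Λ x := fun x => by
    by_cases h : ∃ p : PSpace Y t, p.toMeasure.map e.toFun = (Λ x).bind (evalKernel E) ∧
      c x p ≤ ∫⁻ n, f (ιX x, n) ∂Λ x
    · exact h.imp fun p hp _ => hp
    · exact ⟨ν, fun h' => absurd h' h⟩
  choose κ hκ' using hjensen'
  have hκ : ∀ᵐ x ∂(μ : Measure X), (κ x).toMeasure.map e.toFun = (Λ x).bind (evalKernel E) ∧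
      c x (κ x) ≤ ∫⁻ n, f (ιX x, n) ∂Λ x := hjensen.mono fun x hx => hκ' x hx
  set K : Kernel X E := evalKernel E ∘ₖ Λ with hK
  set M : Measure (X × E) := (μ : Measure X) ⊗ₘ K with hM
  have hMsnd : M.snd = ν.toMeasure.map e.toFun := by
    rw [hM, Measure.snd_compProd, ← hQ2, hK, ← Measure.comp_assoc]
    congr 1
    rw [hdis, Measure.snd_compProd]
    ext A hA
    rw [Measure.bind_apply hA Λ.aemeasurable, Measure.bind_apply hA (Kernel.aemeasurable _),
      lintegral_map (Kernel.measurable_coe _ hA) hιm]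
    rfl
  have hemb : MeasurableEmbedding (Prod.map (id : X → X) e.toFun) :=
    MeasurableEmbedding.id.prodMap hιe
  -- The second marginal of `M` is the image of `ν`, so `M` is carried by the image of `X × Y` and
  -- can be pulled back.
  set π : Measure (X × Y) := M.comap (Prod.map id e.toFun) with hπ
  have hπM : π.map (Prod.map id e.toFun) = M := by
    rw [hπ, hemb.map_comap, Measure.restrict_eq_self_of_ae_mem]
    have h0 : M.snd (range e.toFun)ᶜ = 0 := by
      rw [hMsnd, Measure.map_apply e.measurable hιe.measurableSet_range.compl]
      simp
    rw [Measure.snd_apply hιe.measurableSet_range.compl] at h0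
    refine measure_mono_null ?_ h0
    rintro ⟨x, z⟩ hz ⟨y, rfl⟩
    exact hz ⟨(x, y), rfl⟩
  have hπfst : π.fst = (μ : Measure X) := by
    have h1 : M.fst = (μ : Measure X) := by rw [hM, Measure.fst_compProd]
    rw [← h1, ← hπM, Measure.fst, Measure.fst, Measure.map_map measurable_fst hemb.measurable]
    rfl
  have hπsnd : π.snd = ν.toMeasure := by
    have h1 : π.snd.map e.toFun = ν.toMeasure.map e.toFun := by
      rw [← hMsnd, ← hπM, Measure.snd, Measure.snd, Measure.map_map measurable_snd hemb.measurable,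
        Measure.map_map e.measurable measurable_snd]
      rfl
    rw [← hιe.comap_map π.snd, h1, hιe.comap_map]
  have hπprob : IsProbabilityMeasure π := ⟨by rw [← Measure.fst_univ, hπfst]; exact measure_univ⟩
  -- Both kernels disintegrate `M` over `μ`, so uniqueness of disintegrations applies.
  have hcond : ∀ᵐ x ∂(μ : Measure X), K x = (π.condKernel x).map e.toFun := by
    have h1 : (μ : Measure X) ⊗ₘ K = (μ : Measure X) ⊗ₘ (π.condKernel.map e.toFun) := by
      have h2 := π.disintegrate π.condKernel
      rw [hπfst] at h2
      rw [Measure.compProd_map e.measurable, h2, hπM]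
    filter_upwards [Kernel.ae_eq_of_compProd_eq h1] with x hx
    rw [hx, Kernel.map_apply _ e.measurable]
  refine ⟨⟨π, hπprob⟩, ⟨hπfst, hπsnd⟩, κ, ?_, ?_⟩
  · filter_upwards [hκ, hcond] with x h1 h2
    have h3 : (κ x).toMeasure.map e.toFun = (π.condKernel x).map e.toFun := by
      rw [h1.1, ← h2, hK, Kernel.comp_apply]
    change _ = π.condKernel x
    rw [← hιe.comap_map (κ x).toMeasure, h3, hιe.comap_map]
  · rw [hlint hf.measurable]
    exact lintegral_mono_ae (hκ.mono fun x hx => hx.2)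

end Limit
end WeakTransport

/-! ### Separation by finite-dimensional Hahn–Banach. -/

namespace WeakTransport

open Filter Set ProbabilityTheory

section Integrals

variable {Y : Type*} [MetricSpace Y] [PolishSpace Y] [MeasurableSpace Y] [BorelSpace Y] {t : ℝ}

theorem toReal_edist_rpow (y y₀ : Y) : (edist y y₀ ^ t).toReal = dist y y₀ ^ t := by
  rw [← ENNReal.toReal_rpow, edist_dist, ENNReal.toReal_ofReal dist_nonneg]

theorem PSpace.integrable_dist_rpow (ht : 1 ≤ t) (p : PSpace Y t) (y₀ : Y) :
    Integrable (fun y => dist y y₀ ^ t) p.toMeasure := by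
  have := integrable_toReal_of_lintegral_ne_top (measurable_edist_rpow t y₀).aemeasurable
    (p.moment_lt_top ht y₀).ne
  simpa only [toReal_edist_rpow] using this

theorem PSpace.integral_dist_rpow (ht : 1 ≤ t) (p : PSpace Y t) (y₀ : Y) :
    ∫ y, dist y y₀ ^ t ∂p.toMeasure = (p.moment y₀).toReal := by
  have := integral_toReal (measurable_edist_rpow t y₀).aemeasurable
    (ae_lt_top (measurable_edist_rpow t y₀) (p.moment_lt_top ht y₀).ne)
  simp only [toReal_edist_rpow] at this
  exact this

theorem integrable_of_mem_Phi (ht : 1 ≤ t) {ψ : Y → ℝ} (hψ : ψ ∈ Phi Y t) (p : PSpace Y t) :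
    Integrable ψ p.toMeasure := by
  obtain ⟨hc, a, b, l, y₀, h⟩ := hψ
  refine Integrable.mono' (g := fun y => |l| + |a| + |b| * dist y y₀ ^ t)
    ((integrable_const _).add ((p.integrable_dist_rpow ht y₀).const_mul _))
    hc.aestronglyMeasurable (ae_of_all _ fun y => ?_)
  have h0 : 0 ≤ dist y y₀ ^ t := Real.rpow_nonneg dist_nonneg t
  have h1 := h y
  rw [dist_comm] at h1
  have h2 : b * dist y y₀ ^ t ≤ |b| * dist y y₀ ^ t :=
    mul_le_mul_of_nonneg_right (le_abs_self b) h0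
  rw [Real.norm_eq_abs, abs_le]
  constructor
  · linarith [neg_abs_le l, abs_nonneg a, mul_nonneg (abs_nonneg b) h0, h1.1]
  · linarith [le_abs_self a, abs_nonneg l, h1.2]

end Integrals

theorem nonpos_of_forall_add_mul_lt {A u γ : ℝ} (h : ∀ s, 0 ≤ s → A + s * γ < u) : γ ≤ 0 := by
  by_contra hγ
  push Not at hγ
  have h0 := h 0 le_rfl
  have := h ((u - A) / γ) (div_nonneg (by linarith) hγ.le)
  rw [div_mul_cancel₀ _ hγ.ne'] at this
  linarith

/-- Here `ρ` is the cost coefficient of a separating functional. If `ρ < 0`, it is normalized to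
`-1`; if `ρ = 0`, the cost does not enter and the gap `g > 0` can be scaled up beyond `m`. -/
theorem exists_scaling {ρ g m : ℝ} (hρ : ρ ≤ 0) (hg : -ρ * m < g) (hm : 0 ≤ m) :
    ∃ r : ℝ, 0 < r ∧ r * -ρ ≤ 1 ∧ m < r * g := by
  rcases hρ.eq_or_lt with rfl | hρ
  · have hg0 : 0 < g := by linarith
    refine ⟨(m + 1) / g, by positivity, by simp, ?_⟩
    rw [div_mul_cancel₀ _ hg0.ne']
    linarith
  · have hρ' : 0 < -ρ := by linarith
    refine ⟨1 / -ρ, by positivity, by rw [one_div_mul_cancel hρ'.ne'], ?_⟩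
    rw [one_div, inv_mul_eq_div, lt_div_iff₀ hρ']
    linarith

section Duality

variable {X : Type*} [TopologicalSpace X] [PolishSpace X] [MeasurableSpace X] [BorelSpace X]
  {Y : Type*} [MetricSpace Y] [PolishSpace Y] [MeasurableSpace Y] [BorelSpace Y] {t : ℝ}
  {E : Type*} [MetricSpace E] [CompactSpace E] [MeasurableSpace E] [BorelSpace E]
  {F : Type*} [MetricSpace F] [CompactSpace F] [MeasurableSpace F] [BorelSpace F]

theorem exists_coeff {N : ℕ} (L : StrongDual ℝ ((Fin N → ℝ) × (Fin N → ℝ) × ℝ × ℝ)) :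
    ∃ (α β : Fin N → ℝ) (γ ρ : ℝ), ∀ v, L v =
      ∑ j, v.1 j * α j + ∑ j, v.2.1 j * β j + v.2.2.1 * γ + v.2.2.2 * ρ := by
  let L₁ : (Fin N → ℝ) →ₗ[ℝ] ℝ := L.toLinearMap ∘ₗ LinearMap.inl _ _ _
  let L₂ : (Fin N → ℝ) →ₗ[ℝ] ℝ := L.toLinearMap ∘ₗ LinearMap.inr _ _ _ ∘ₗ LinearMap.inl _ _ _
  refine ⟨fun j => L₁ fun i => if j = i then 1 else 0,
    fun j => L₂ fun i => if j = i then 1 else 0, L (0, 0, 1, 0), L (0, 0, 0, 1),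
    fun v => ?_⟩
  have h₁ := L₁.pi_apply_eq_sum_univ v.1
  have h₂ := L₂.pi_apply_eq_sum_univ v.2.1
  have hv : v = (v.1, 0, 0, 0) + (0, v.2.1, 0, 0) + v.2.2.1 • (0, 0, 1, 0)
      + v.2.2.2 • ((0, 0, 0, 1) : (Fin N → ℝ) × (Fin N → ℝ) × ℝ × ℝ) := by
    ext <;> simp
  conv_lhs => rw [hv]
  rw [map_add, map_add, map_add, map_smul, map_smul]
  have e₁ : L (v.1, 0, 0, 0) = L₁ v.1 := rfl
  have e₂ : L (0, v.2.1, 0, 0) = L₂ v.2.1 := rfl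
  rw [e₁, e₂, h₁, h₂]
  simp only [smul_eq_mul]

/-- The point given by the constraints lies in the closed convex hull of the values attained at
`X × 𝒫ᵗ(Y)`, unless a dual pair has value larger than `m`. -/
theorem MomentEmbedding.mem_closure_convexHull (e : MomentEmbedding Y E t) (ht : 1 ≤ t)
    {ιX : X → F} (hιX : Continuous ιX) (c : X → PSpace Y t → ℝ≥0∞)
    (μ : ProbabilityMeasure X) (ν : PSpace Y t) {m : ℝ} (hm : 0 ≤ m)
    (hdual : ∀ (φ : BoundedContinuousFunction X ℝ), ∀ ψ ∈ Phi Y t,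
      (∀ x p, (φ x : EReal) ≤ ((∫ y, ψ y ∂p.toMeasure : ℝ) : EReal) + (c x p : EReal)) →
      ∫ x, φ x ∂(μ : Measure X) - ∫ y, ψ y ∂ν.toMeasure ≤ m) (N : ℕ) :
    ((fun j : Fin N => ∫ x, denseTest F j (ιX x) ∂(μ : Measure X),
      fun j : Fin N => ∫ y, denseTest E j (e.toFun y) ∂ν.toMeasure,
      (ν.moment e.base).toReal, m) : (Fin N → ℝ) × (Fin N → ℝ) × ℝ × ℝ) ∈
    closure (convexHull ℝ {v | ∃ (x : X) (p : PSpace Y t) (s r : ℝ), 0 ≤ s ∧ 0 ≤ r ∧ c x p ≠ ∞ ∧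
      v = (fun j : Fin N => denseTest F j (ιX x),
        fun j : Fin N => ∫ y, denseTest E j (e.toFun y) ∂p.toMeasure,
        (p.moment e.base).toReal + s, (c x p).toReal + r)}) := by
  by_contra hnot
  obtain ⟨L, u, hL, hLu⟩ := geometric_hahn_banach_closed_point
    ((convex_convexHull ℝ _).closure) isClosed_closure hnot
  obtain ⟨α, β, γ, ρ, hcoef⟩ := exists_coeff L
  set A : C(F, ℝ) := ∑ j, α j • denseTest F (j : Fin N) with hA
  set B : C(E, ℝ) := ∑ j, β j • denseTest E (j : Fin N) with hB
  have hGint (p : PSpace Y t) (G : C(E, ℝ)) : Integrable (fun y => G (e.toFun y)) p.toMeasure :=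
    ((BoundedContinuousFunction.mkOfCompact G).compContinuous
      ⟨e.toFun, e.isEmbedding.continuous⟩).integrable _
  have hFint (G : C(F, ℝ)) : Integrable (fun x => G (ιX x)) (μ : Measure X) :=
    ((BoundedContinuousFunction.mkOfCompact G).compContinuous ⟨ιX, hιX⟩).integrable _
  have hAx (x) : ∑ j : Fin N, denseTest F j (ιX x) * α j = A (ιX x) := by
    simp [hA, mul_comm]
  have hBp (p : PSpace Y t) : ∑ j : Fin N, (∫ y, denseTest E j (e.toFun y) ∂p.toMeasure) * β j
      = ∫ y, B (e.toFun y) ∂p.toMeasure := by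
    simp_rw [← integral_mul_const]
    rw [← integral_finsetSum _ fun j _ => (hGint p _).mul_const _]
    refine integral_congr_ae (ae_of_all _ fun y => ?_)
    simp [hB, mul_comm]
  have hAμ : ∑ j : Fin N, (∫ x, denseTest F j (ιX x) ∂(μ : Measure X)) * α j
      = ∫ x, A (ιX x) ∂(μ : Measure X) := by
    simp_rw [← integral_mul_const]
    rw [← integral_finsetSum _ fun j _ => (hFint _).mul_const _]
    exact integral_congr_ae (ae_of_all _ hAx)
  have hS (x : X) (p : PSpace Y t) (h : c x p ≠ ∞) (s r : ℝ) (hs : 0 ≤ s) (hr : 0 ≤ r) :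
      A (ιX x) + ∫ y, B (e.toFun y) ∂p.toMeasure + ((p.moment e.base).toReal + s) * γ
        + ((c x p).toReal + r) * ρ < u := by
    have := hL _ (subset_closure (subset_convexHull ℝ _ ⟨x, p, s, r, hs, hr, h, rfl⟩))
    rw [hcoef] at this
    simpa only [hAx, hBp] using this
  rw [hcoef] at hLu
  simp only [hAμ, hBp] at hLu
  -- If the cost were identically infinite, the pair `(m + 1, 0)` would be admissible with value
  -- above `m`.
  obtain ⟨x₀, p₀, h₀⟩ : ∃ x p, c x p ≠ ∞ := by
    by_contra h
    push Not at h
    have := hdual (BoundedContinuousFunction.const X (m + 1)) 0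
      ⟨continuous_const, 0, 0, 0, e.base, fun y => by simp⟩ fun x p => by
        rw [h x p, EReal.coe_ennreal_top, EReal.coe_add_top]; exact le_top
    simp at this
    linarith
  -- The slacks `s` and `r` may be arbitrarily large, which forces the signs of their coefficients.
  -- The sign of `γ` makes `ψ` below bounded from below.
  have hγ : γ ≤ 0 := nonpos_of_forall_add_mul_lt (u := u) (A := A (ιX x₀)
    + ∫ y, B (e.toFun y) ∂p₀.toMeasure + (p₀.moment e.base).toReal * γ + (c x₀ p₀).toReal * ρ)
    fun s hs => by have := hS x₀ p₀ h₀ s 0 hs le_rfl; linarith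
  have hρ : ρ ≤ 0 := nonpos_of_forall_add_mul_lt (u := u) (A := A (ιX x₀)
    + ∫ y, B (e.toFun y) ∂p₀.toMeasure + (p₀.moment e.base).toReal * γ + (c x₀ p₀).toReal * ρ)
    fun s hs => by have := hS x₀ p₀ h₀ 0 s le_rfl hs; linarith
  obtain ⟨k, hk, hkρ, hkm⟩ := exists_scaling (g := ∫ x, A (ιX x) ∂(μ : Measure X)
    + ∫ y, B (e.toFun y) ∂ν.toMeasure + (ν.moment e.base).toReal * γ - u) hρ (by linarith) hm
  -- Isolating the terms in `x` in the separation inequality and scaling by `k` gives `φ = k (A -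
  -- u)` and this `ψ`. Admissibility uses `k * -ρ ≤ 1`; the dual value is `k` times the gap, hence
  -- above `m`.
  let ψ : Y → ℝ := fun y => k * (-B (e.toFun y) - γ * dist y e.base ^ t)
  have hψint (p : PSpace Y t) : ∫ y, ψ y ∂p.toMeasure
      = k * (-(∫ y, B (e.toFun y) ∂p.toMeasure) - γ * (p.moment e.base).toReal) := by
    rw [integral_const_mul, integral_sub (by exact (hGint p B).neg)
      ((p.integrable_dist_rpow ht e.base).const_mul γ), integral_const_mul, integral_neg,
      p.integral_dist_rpow ht]
  have hψ : ψ ∈ Phi Y t := by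
    refine ⟨?_, k * ‖B‖, k * -γ, -(k * ‖B‖), e.base, fun y => ?_⟩
    · have : Continuous fun y => dist y e.base ^ t :=
        (continuous_id.dist continuous_const).rpow_const fun _ => Or.inr (by linarith)
      exact continuous_const.mul ((B.continuous.comp e.isEmbedding.continuous).neg.sub
        (continuous_const.mul this))
    · have h1 := abs_le.1 (B.norm_coe_le_norm (e.toFun y))
      have h2 : 0 ≤ -γ * dist y e.base ^ t :=
        mul_nonneg (by linarith) (Real.rpow_nonneg dist_nonneg t)
      rw [dist_comm]
      constructor
      · have := mul_le_mul_of_nonneg_left (show -‖B‖ ≤ -B (e.toFun y) - γ * dist y e.base ^ t by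
          linarith [h1.2]) hk.le
        simpa using this
      · have := mul_le_mul_of_nonneg_left (show -B (e.toFun y) - γ * dist y e.base ^ t
          ≤ ‖B‖ + -γ * dist y e.base ^ t by linarith [h1.1]) hk.le
        calc ψ y ≤ _ := this
          _ = _ := by ring
  let φ : BoundedContinuousFunction X ℝ :=
    (BoundedContinuousFunction.mkOfCompact (k • (A - ContinuousMap.const F u))).compContinuous
      ⟨ιX, hιX⟩
  have hφ (x) : φ x = k * (A (ιX x) - u) := rfl
  have hval := hdual φ ψ hψ fun x p => by
    by_cases h : c x p = ∞
    · rw [h, EReal.coe_ennreal_top, EReal.coe_add_top]; exact le_top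
    · rw [← EReal.coe_ennreal_toReal h, ← EReal.coe_add, EReal.coe_le_coe_iff, hφ, hψint]
      have h1 := hS x p h 0 0 le_rfl le_rfl
      have h2 := mul_le_mul_of_nonneg_right hkρ (ENNReal.toReal_nonneg (a := c x p))
      have h3 := mul_le_mul_of_nonneg_left h1.le hk.le
      nlinarith [h2, h3]
  simp_rw [hφ] at hval
  rw [integral_const_mul, integral_sub (hFint A) (integrable_const _), hψint] at hval
  simp only [integral_const, probReal_univ, smul_eq_mul, one_mul] at hval
  nlinarith [hval, hkm]

end Duality
end WeakTransport

/-! ### Finitely supported approximate solutions. -/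

namespace WeakTransport

open Filter Set ProbabilityTheory

section FiniteSupport

variable {W : Type*} [MeasurableSpace W]

/-- The discrete probability measure with weights `w` at the points `z`. -/
theorem exists_discrete {κ : Type*} [Fintype κ] (w : κ → ℝ) (z : κ → W) (hw : ∀ i, 0 ≤ w i)
    (h1 : ∑ i, w i = 1) : ∃ P : ProbabilityMeasure W,
      (∀ A : Set W, MeasurableSet A → (∀ i, z i ∈ A) → ∀ᵐ x ∂(P : Measure W), x ∈ A) ∧
      (∀ g : W → ℝ, Measurable g → ∫ x, g x ∂(P : Measure W) = ∑ i, w i * g (z i)) ∧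
      ∀ g : W → ℝ≥0∞, Measurable g →
        ∫⁻ x, g x ∂(P : Measure W) = ∑ i, ENNReal.ofReal (w i) * g (z i) := by
  let P : Measure W := ∑ i, ENNReal.ofReal (w i) • Measure.dirac (z i)
  have hP : IsProbabilityMeasure P := by
    constructor
    simp only [P, Measure.finsetSum_apply, Measure.smul_apply, measure_univ, smul_eq_mul, mul_one]
    rw [← ENNReal.ofReal_sum_of_nonneg fun i _ => hw i, h1, ENNReal.ofReal_one]
  refine ⟨⟨P, hP⟩, fun A hA hz => ?_, fun g hg => ?_, fun g hg => ?_⟩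
  · change P Aᶜ = 0
    simp only [P, Measure.finsetSum_apply, Measure.smul_apply, smul_eq_mul,
      Measure.dirac_apply' _ hA.compl]
    simp [hz]
  · change ∫ x, g x ∂P = _
    rw [integral_finsetSum_measure]
    · simp_rw [integral_smul_measure, ENNReal.toReal_ofReal (hw _), smul_eq_mul]
      exact Finset.sum_congr rfl fun i _ => by rw [integral_dirac' _ _ hg.stronglyMeasurable]
    · intro i _
      refine Integrable.smul_measure ?_ ENNReal.ofReal_ne_top
      exact ⟨hg.aestronglyMeasurable, by
        rw [HasFiniteIntegral, lintegral_dirac' _ hg.enorm]; exact enorm_lt_top⟩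
  · change ∫⁻ x, g x ∂P = _
    rw [lintegral_finsetSum_measure]
    simp_rw [lintegral_smul_measure, lintegral_dirac' _ hg, smul_eq_mul]

end FiniteSupport

section Duality

variable {X : Type*} [TopologicalSpace X] [PolishSpace X] [MeasurableSpace X] [BorelSpace X]
  {Y : Type*} [MetricSpace Y] [PolishSpace Y] [MeasurableSpace Y] [BorelSpace Y] {t : ℝ}
  {E : Type*} [MetricSpace E] [CompactSpace E] [MeasurableSpace E] [BorelSpace E]
  {F : Type*} [MetricSpace F] [CompactSpace F] [MeasurableSpace F] [BorelSpace F]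

/-- A point of the convex hull close to the target is a finite convex combination, and its weights
define `P`. Dropping the nonnegative slacks leaves one-sided bounds for the moment and the cost. -/
theorem MomentEmbedding.exists_approx (e : MomentEmbedding Y E t) (ht : 1 ≤ t)
    {ιX : X → F} (hιX : Continuous ιX) (c : X → PSpace Y t → ℝ≥0∞)
    {f : F × (ProbabilityMeasure E × ℝ≥0∞) → ℝ≥0∞}
    (hf : LowerSemicontinuous f) (hfc : ∀ x p, f (ιX x, e.embed p) = c x p)
    (μ : ProbabilityMeasure X) (ν : PSpace Y t) {m : ℝ} (hm : 0 ≤ m)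
    (hdual : ∀ (φ : BoundedContinuousFunction X ℝ), ∀ ψ ∈ Phi Y t,
      (∀ x p, (φ x : EReal) ≤ ((∫ y, ψ y ∂p.toMeasure : ℝ) : EReal) + (c x p : EReal)) →
      ∫ x, φ x ∂(μ : Measure X) - ∫ y, ψ y ∂ν.toMeasure ≤ m) (N : ℕ) {ε : ℝ} (hε : 0 < ε) :
    ∃ P : ProbabilityMeasure (F × (ProbabilityMeasure E × ℝ≥0∞)),
      (∀ᵐ w ∂(P : Measure (F × (ProbabilityMeasure E × ℝ≥0∞))),
        ∫⁻ z, e.weight z ∂(w.2.1 : Measure E) ≤ w.2.2) ∧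
      (∀ j < N, |∫ w, denseTest F j w.1 ∂(P : Measure (F × (ProbabilityMeasure E × ℝ≥0∞)))
        - ∫ x, denseTest F j (ιX x) ∂(μ : Measure X)| < ε) ∧
      (∀ j < N, |∫ w, ∫ z, denseTest E j z ∂(w.2.1 : Measure E)
        ∂(P : Measure (F × (ProbabilityMeasure E × ℝ≥0∞)))
        - ∫ y, denseTest E j (e.toFun y) ∂ν.toMeasure| < ε) ∧
      ∫⁻ w, w.2.2 ∂(P : Measure (F × (ProbabilityMeasure E × ℝ≥0∞)))
        ≤ ν.moment e.base + ENNReal.ofReal ε ∧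
      ∫⁻ w, f w ∂(P : Measure (F × (ProbabilityMeasure E × ℝ≥0∞)))
        ≤ ENNReal.ofReal m + ENNReal.ofReal ε := by
  obtain ⟨v, hv, hdist⟩ := Metric.mem_closure_iff.1
    (e.mem_closure_convexHull ht hιX c μ ν hm hdual N) ε hε
  obtain ⟨κ, _, w, z, hw, hw1, hz, rfl⟩ := mem_convexHull_iff_exists_fintype.1 hv
  choose x p s r hs hr hc hz using hz
  obtain ⟨P, hPA, hPr, hPl⟩ := exists_discrete w (fun i => (ιX (x i), e.embed (p i))) hw hw1
  have hmom (i) : (p i).moment e.base ≠ ∞ := ((p i).moment_lt_top ht e.base).ne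
  rw [Prod.dist_eq, Prod.dist_eq, Prod.dist_eq, max_lt_iff, max_lt_iff, max_lt_iff] at hdist
  obtain ⟨h1, h2, h3, h4⟩ := hdist
  rw [dist_pi_lt_iff hε] at h1 h2
  simp only [hz, Prod.fst_sum, Prod.snd_sum, Prod.smul_fst, Prod.smul_snd, Finset.sum_apply,
    Pi.smul_apply, smul_eq_mul, Real.dist_eq] at h1 h2 h3 h4
  have hjc (j) : Continuous fun w : F × (ProbabilityMeasure E × ℝ≥0∞) =>
      ∫ z, denseTest E j z ∂(w.2.1 : Measure E) :=
    (ProbabilityMeasure.continuous_integral_continuousMap (denseTest E j)).comp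
      (continuous_fst.comp continuous_snd)
  refine ⟨P, ?_, fun j hj => ?_, fun j hj => ?_, ?_, ?_⟩
  · exact hPA _ ((isClosed_lintegral_le e.continuous_weight.lowerSemicontinuous).preimage
      continuous_snd).measurableSet fun i => (e.lintegral_weight (p i)).le
  · rw [hPr (fun w => denseTest F j w.1) ((denseTest F j).continuous.measurable.comp measurable_fst), abs_sub_comm]
    exact h1 ⟨j, hj⟩
  · rw [hPr _ (hjc j).measurable, abs_sub_comm]
    have h5 (i) : ∫ z, denseTest E j z ∂((e.embed (p i)).1 : Measure E)
        = ∫ y, denseTest E j (e.toFun y) ∂(p i).toMeasure := by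
      rw [e.embed_fst, integral_map e.measurable.aemeasurable
        (denseTest E j).continuous.measurable.aestronglyMeasurable]
    simp_rw [h5]
    exact h2 ⟨j, hj⟩
  · rw [hPl (fun w => w.2.2) (measurable_snd.comp measurable_snd)]
    have h5 : ∑ i, w i * ((p i).moment e.base).toReal ≤ (ν.moment e.base).toReal + ε := by
      have : ∑ i, w i * ((p i).moment e.base).toReal
          ≤ ∑ i, w i * (((p i).moment e.base).toReal + s i) :=
        Finset.sum_le_sum fun i _ => mul_le_mul_of_nonneg_left (by linarith [hs i]) (hw i)
      linarith [(abs_lt.1 h3).1]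
    have h6 := ENNReal.ofReal_le_ofReal h5
    rw [ENNReal.ofReal_add ENNReal.toReal_nonneg hε.le,
      ENNReal.ofReal_toReal (ν.moment_lt_top ht e.base).ne, ENNReal.ofReal_sum_of_nonneg
      fun i _ => mul_nonneg (hw i) ENNReal.toReal_nonneg] at h6
    simp_rw [ENNReal.ofReal_mul (hw _), ENNReal.ofReal_toReal (hmom _)] at h6
    exact h6
  · rw [hPl _ hf.measurable]
    have h5 : ∑ i, w i * (c (x i) (p i)).toReal ≤ m + ε := by
      have : ∑ i, w i * (c (x i) (p i)).toReal ≤ ∑ i, w i * ((c (x i) (p i)).toReal + r i) :=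
        Finset.sum_le_sum fun i _ => mul_le_mul_of_nonneg_left (by linarith [hr i]) (hw i)
      linarith [(abs_lt.1 h4).1]
    have h6 := ENNReal.ofReal_le_ofReal h5
    rw [ENNReal.ofReal_add hm hε.le, ENNReal.ofReal_sum_of_nonneg
      fun i _ => mul_nonneg (hw i) ENNReal.toReal_nonneg] at h6
    simp_rw [ENNReal.ofReal_mul (hw _), ENNReal.ofReal_toReal (hc _)] at h6
    simp_rw [hfc]
    exact h6

end Duality

end WeakTransport

/-! ### Calculus of the extended integral. -/

namespace WeakTransport

open Filter Set ProbabilityTheory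

section EIntegral

variable {X : Type*} [MeasurableSpace X] {μ : Measure X}

theorem eintegral_mono_ae {f g : X → EReal} (h : ∀ᵐ x ∂μ, f x ≤ g x) :
    eintegral μ f ≤ eintegral μ g := by
  refine EReal.sub_le_sub ?_ ?_
  · exact EReal.coe_ennreal_le_coe_ennreal_iff.2
      (lintegral_mono_ae (h.mono fun x hx => EReal.toENNReal_le_toENNReal hx))
  · exact EReal.coe_ennreal_le_coe_ennreal_iff.2
      (lintegral_mono_ae (h.mono fun x hx => EReal.toENNReal_le_toENNReal (EReal.neg_le_neg_iff.2 hx)))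

theorem eintegral_congr_ae {f g : X → EReal} (h : ∀ᵐ x ∂μ, f x = g x) :
    eintegral μ f = eintegral μ g :=
  le_antisymm (eintegral_mono_ae (h.mono fun _ hx => hx.le))
    (eintegral_mono_ae (h.mono fun _ hx => hx.ge))

/-- The relation between positive and negative parts is rearranged without subtraction, so it holds
also for `v = ∞` and can be integrated termwise. -/
theorem toENNReal_coe_add (u : ℝ) (v : ℝ≥0∞) :
    ((u : EReal) + v).toENNReal + ENNReal.ofReal (-u)
      = (-((u : EReal) + v)).toENNReal + ENNReal.ofReal u + v := by
  induction v using ENNReal.recTopCoe with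
  | top => simp
  | coe v =>
    have h : ((v : ℝ≥0∞) : EReal) = ((v : ℝ) : EReal) := rfl
    rw [h, ← EReal.coe_add, ← EReal.coe_neg, EReal.toENNReal_of_ne_top (EReal.coe_ne_top _),
      EReal.toENNReal_of_ne_top (EReal.coe_ne_top _), EReal.toReal_coe, EReal.toReal_coe,
      ← ENNReal.ofReal_coe_nnreal]
    have hv : (0 : ℝ) ≤ v := v.2
    rcases le_total 0 u with hu | hu
    · rw [ENNReal.ofReal_of_nonpos (show -u ≤ 0 by linarith),
        ENNReal.ofReal_of_nonpos (show -(u + v) ≤ 0 by linarith [NNReal.coe_nonneg v]),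
        ENNReal.ofReal_add hu hv]
      simp
    · rcases le_total 0 (u + v) with h | h
      · rw [ENNReal.ofReal_of_nonpos hu, ENNReal.ofReal_of_nonpos (show -(u + v) ≤ 0 by linarith),
          ← ENNReal.ofReal_add h (by linarith)]
        simp
      · rw [ENNReal.ofReal_of_nonpos hu, ENNReal.ofReal_of_nonpos h, add_zero, zero_add,
          ← ENNReal.ofReal_add (by linarith) hv]
        congr 1
        ring

theorem eintegral_coe_add {u : X → ℝ} {v : X → ℝ≥0∞} (hu : Integrable u μ) (hum : Measurable u)
    (hv : Measurable v) :
    eintegral μ (fun x => (u x : EReal) + v x)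
      = ((∫ x, u x ∂μ : ℝ) : EReal) + ((∫⁻ x, v x ∂μ : ℝ≥0∞) : EReal) := by
  have hg : Measurable fun x => (u x : EReal) + v x :=
    hum.coe_real_ereal.add hv.coe_ereal_ennreal
  have hp : ∫⁻ x, ENNReal.ofReal (u x) ∂μ ≠ ∞ := hu.lintegral_lt_top.ne
  have hn : ∫⁻ x, ENNReal.ofReal (-u x) ∂μ ≠ ∞ := hu.neg.lintegral_lt_top.ne
  have hgn : ∫⁻ x, (-((u x : EReal) + v x)).toENNReal ∂μ ≠ ∞ := by
    refine ne_top_of_le_ne_top hn (lintegral_mono fun x => ?_)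
    have : -((u x : EReal) + v x) ≤ ((-u x : ℝ) : EReal) := by
      rw [EReal.coe_neg, EReal.neg_le_neg_iff]
      exact le_add_of_nonneg_right (EReal.coe_ennreal_nonneg _)
    refine (EReal.toENNReal_le_toENNReal this).trans ?_
    rw [EReal.toENNReal_of_ne_top (EReal.coe_ne_top _), EReal.toReal_coe]
  have hsum : ∫⁻ x, ((u x : EReal) + v x).toENNReal ∂μ + ∫⁻ x, ENNReal.ofReal (-u x) ∂μ
      = ∫⁻ x, (-((u x : EReal) + v x)).toENNReal ∂μ + ∫⁻ x, ENNReal.ofReal (u x) ∂μ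
        + ∫⁻ x, v x ∂μ := by
    rw [← lintegral_add_left hg.ereal_toENNReal, ← lintegral_add_left (by exact hg.neg.ereal_toENNReal),
      ← lintegral_add_left (by exact hg.neg.ereal_toENNReal.add hum.ennreal_ofReal)]
    exact lintegral_congr fun x => toENNReal_coe_add (u x) (v x)
  unfold eintegral
  rw [integral_eq_lintegral_pos_part_sub_lintegral_neg_part hu]
  generalize ∫⁻ x, ((u x : EReal) + v x).toENNReal ∂μ = a at *
  generalize ∫⁻ x, (-((u x : EReal) + v x)).toENNReal ∂μ = b at *
  generalize ∫⁻ x, ENNReal.ofReal (u x) ∂μ = p at *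
  generalize ∫⁻ x, ENNReal.ofReal (-u x) ∂μ = n at *
  generalize ∫⁻ x, v x ∂μ = w at *
  lift b to NNReal using hgn
  lift p to NNReal using hp
  lift n to NNReal using hn
  induction w using ENNReal.recTopCoe with
  | top =>
    have ha : a = ∞ := by
      by_contra h
      lift a to NNReal using h
      simp [← ENNReal.coe_add] at hsum
    subst ha
    simp only [EReal.coe_ennreal_top, EReal.coe_add_top]
    exact EReal.top_sub_coe _
  | coe w =>
    have ha : a ≠ ∞ := by
      rintro rfl
      simp [← ENNReal.coe_add] at hsum
    lift a to NNReal using ha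
    have h1 : (a : ℝ) + n = b + p + w := by exact_mod_cast hsum
    change ((a : ℝ) : EReal) - ((b : ℝ) : EReal) = (((p : ℝ) - (n : ℝ) : ℝ) : EReal) + ((w : ℝ) : EReal)
    rw [← EReal.coe_sub, ← EReal.coe_add]
    congr 1
    linarith

end EIntegral

/-! ### Existence of the embeddings. -/

section Embeddings

theorem exists_isEmbedding_hilbertCube (X : Type*) [TopologicalSpace X] [PolishSpace X]
    [Nonempty X] : ∃ ι : X → ℕ → unitInterval, IsEmbedding ι := by
  let := TopologicalSpace.metrizableSpaceMetric X
  let u := TopologicalSpace.denseSeq X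
  let ι : X → ℕ → unitInterval := fun x n =>
    ⟨min 1 (dist x (u n)), le_min zero_le_one dist_nonneg, min_le_left _ _⟩
  have hι : Continuous ι := by fun_prop
  refine ⟨ι, IsInducing.isEmbedding (isInducing_iff_nhds.2 fun x => le_antisymm
    (hι.tendsto x).le_comap ?_)⟩
  refine (Metric.nhds_basis_ball.ge_iff).2 fun ε hε => ?_
  have hδ : 0 < min 1 (ε / 2) := by positivity
  obtain ⟨n, hn⟩ := (TopologicalSpace.denseRange_denseSeq X).exists_dist_lt x hδ
  refine mem_comap.2 ⟨{g | (g n : ℝ) < min 1 (ε / 2)}, ?_, fun y hy => ?_⟩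
  · refine IsOpen.mem_nhds (isOpen_lt (by fun_prop) continuous_const) ?_
    exact (min_le_right _ _).trans_lt hn
  · have h1 : min 1 (dist y (u n)) < min 1 (ε / 2) := hy
    have h2 : dist y (u n) < ε / 2 := by
      rcases min_lt_iff.1 h1 with h | h
      · exact absurd (h.trans_le (min_le_left _ _)) (lt_irrefl _)
      · exact h.trans_le (min_le_right _ _)
    have h3 := hn.trans_le (min_le_right _ _)
    have h4 := dist_triangle_right y x (u n)
    rw [Metric.mem_ball]
    change dist x (u n) < _ at h3
    linarith

/-- Adjoining `d(y, y₀)ᵗ` as an extra coordinate in `[0, ∞]` turns its extension into a projection.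
-/
theorem nonempty_momentEmbedding (Y : Type*) [MetricSpace Y] [PolishSpace Y] [Nonempty Y] (t : ℝ) :
    Nonempty (MomentEmbedding Y (ℝ≥0∞ × (ℕ → unitInterval)) t) := by
  obtain ⟨ι, hι⟩ := exists_isEmbedding_hilbertCube Y
  obtain ⟨y₀⟩ := ‹Nonempty Y›
  have hw : Continuous fun y => edist y y₀ ^ t :=
    ENNReal.continuous_rpow_const.comp (continuous_id.edist continuous_const)
  exact ⟨{
    toFun := fun y => (edist y y₀ ^ t, ι y)
    isEmbedding := IsEmbedding.of_comp (hw.prodMk hι.continuous) continuous_snd hι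
    base := y₀
    weight := Prod.fst
    continuous_weight := continuous_fst
    weight_apply := fun _ => rfl }⟩

end Embeddings

/-! ### Conditional laws have finite moments. -/

section Disintegration

variable {X : Type*} [MeasurableSpace X]
  {Y : Type*} [MetricSpace Y] [PolishSpace Y] [MeasurableSpace Y] [BorelSpace Y] {t : ℝ}

theorem costAt_toMeasure (C : X → PSpace Y t → EReal) (x : X) (q : PSpace Y t) :
    costAt C x q.toMeasure = C x q := by
  have h : ∃ q' : PSpace Y t, q'.toMeasure = q.toMeasure := ⟨q, rfl⟩
  rw [costAt, dif_pos h, PSpace.toMeasure_injective h.choose_spec]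

theorem bind_condKernel [Nonempty Y] {μ : ProbabilityMeasure X} {ν : PSpace Y t}
    {π : ProbabilityMeasure (X × Y)} (hπ : π ∈ couplings μ ν.toProb) :
    (μ : Measure X).bind (π : Measure (X × Y)).condKernel = ν.toMeasure := by
  rw [← hπ.1, ← Measure.snd_compProd, (π : Measure (X × Y)).disintegrate]
  exact hπ.2

theorem ae_exists_toMeasure_eq_condKernel (ht : 1 ≤ t) [Nonempty Y] {μ : ProbabilityMeasure X}
    {ν : PSpace Y t} {π : ProbabilityMeasure (X × Y)} (hπ : π ∈ couplings μ ν.toProb) :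
    ∀ᵐ x ∂(μ : Measure X), ∃ q : PSpace Y t,
      q.toMeasure = (π : Measure (X × Y)).condKernel x := by
  obtain ⟨y₀⟩ := ‹Nonempty Y›
  have hm := measurable_edist_rpow t y₀
  have h := ν.moment_lt_top ht y₀
  rw [PSpace.moment, ← bind_condKernel hπ,
    Measure.lintegral_bind (Kernel.aemeasurable _) hm.aemeasurable] at h
  filter_upwards [ae_lt_top hm.lintegral_kernel h.ne] with x hx
  exact ⟨⟨⟨(π : Measure (X × Y)).condKernel x, inferInstance⟩, y₀, hx⟩, rfl⟩

end Disintegration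

end WeakTransport

/-! ### Weak and strong duality. -/

namespace WeakTransport

open Filter Set ProbabilityTheory

section Main

variable {X : Type*} [TopologicalSpace X] [PolishSpace X] [MeasurableSpace X] [BorelSpace X]
  {Y : Type*} [MetricSpace Y] [PolishSpace Y] [MeasurableSpace Y] [BorelSpace Y] [Nonempty Y]
  {t : ℝ}
  {E : Type*} [MetricSpace E] [CompactSpace E] [MeasurableSpace E] [BorelSpace E]
  {F : Type*} [MetricSpace F] [CompactSpace F] [MeasurableSpace F] [BorelSpace F]

/-- The shifted cost along a disintegration has a measurable version. -/
theorem MomentEmbedding.exists_measurable_cost (e : MomentEmbedding Y E t) (ht : 1 ≤ t)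
    {ιX : X → F} (hιX : Continuous ιX) {C : X → PSpace Y t → EReal} {K : ℝ}
    (hK : ∀ x p, (K : EReal) ≤ C x p) {f : F × (ProbabilityMeasure E × ℝ≥0∞) → ℝ≥0∞}
    (hf : LowerSemicontinuous f)
    (hfc : ∀ x p, f (ιX x, e.embed p) = (C x p - K).toENNReal)
    {μ : ProbabilityMeasure X} {ν : PSpace Y t} {π : ProbabilityMeasure (X × Y)}
    (hπ : π ∈ couplings μ ν.toProb) :
    ∃ v : X → ℝ≥0∞, Measurable v ∧
      eintegral (μ : Measure X) (fun x => costAt C x ((π : Measure (X × Y)).condKernel x))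
        = (K : EReal) + ((∫⁻ x, v x ∂(μ : Measure X) : ℝ≥0∞) : EReal) ∧
      ∀ᵐ x ∂(μ : Measure X), ∀ q : PSpace Y t,
        q.toMeasure = (π : Measure (X × Y)).condKernel x → v x = (C x q - K).toENNReal := by
  set κ := (π : Measure (X × Y)).condKernel with hκ
  have hprob (x : X) : IsProbabilityMeasure ((κ x).map e.toFun) :=
    Measure.isProbabilityMeasure_map e.measurable.aemeasurable
  -- Evaluating the Borel function `f` along the kernel gives measurability, which is not evident
  -- for `costAt` with its choice of representative.
  let v : X → ℝ≥0∞ := fun x =>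
    f (ιX x, ⟨(κ x).map e.toFun, hprob x⟩, ∫⁻ y, edist y e.base ^ t ∂κ x)
  have hv : Measurable v := by
    refine hf.measurable.comp (hιX.measurable.prodMk (Measurable.prodMk ?_ ?_))
    · exact ((Measure.measurable_map _ e.measurable).comp κ.measurable).subtype_mk
    · exact (measurable_edist_rpow t e.base).lintegral_kernel
  have hvq (x : X) (q : PSpace Y t) (hq : q.toMeasure = κ x) : v x = (C x q - K).toENNReal := by
    rw [← hfc]
    have h1 : (⟨(κ x).map e.toFun, hprob x⟩ : ProbabilityMeasure E) = (e.embed q).1 :=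
      Subtype.ext (by
        change (κ x).map e.toFun = q.toMeasure.map e.toFun
        rw [hq])
    have h2 : ∫⁻ y, edist y e.base ^ t ∂κ x = (e.embed q).2 := by rw [← hq]; rfl
    simp only [v, h1, h2]
  refine ⟨v, hv, ?_, ae_of_all _ hvq⟩
  have h := eintegral_coe_add (μ := (μ : Measure X)) (u := fun _ => K) (integrable_const K)
    measurable_const hv
  rw [integral_const, probReal_univ, one_smul] at h
  rw [← h]
  refine eintegral_congr_ae ?_
  filter_upwards [ae_exists_toMeasure_eq_condKernel ht hπ] with x hx
  obtain ⟨q, hq⟩ := hx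
  rw [hvq x q hq, coe_add_toENNReal_sub (hK x q), ← hq, costAt_toMeasure]

theorem integrable_integral_condKernel (ht : 1 ≤ t) {μ : ProbabilityMeasure X} {ν : PSpace Y t}
    {π : ProbabilityMeasure (X × Y)} (hπ : π ∈ couplings μ ν.toProb) {ψ : Y → ℝ}
    (hψ : ψ ∈ Phi Y t) :
    Integrable (fun x => ∫ y, ψ y ∂(π : Measure (X × Y)).condKernel x) (μ : Measure X) ∧
    ∫ x, ∫ y, ψ y ∂(π : Measure (X × Y)).condKernel x ∂(μ : Measure X)
      = ∫ y, ψ y ∂ν.toMeasure := by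
  have h := integrable_of_mem_Phi ht hψ ν
  rw [← bind_condKernel hπ] at h ⊢
  refine ⟨?_, (integral_bind _ _ h).symm⟩
  rw [Measure.comp_eq_comp_const_apply] at h
  have := h.integral_comp
  rwa [Kernel.const_apply] at this

/-- Weak duality. -/
theorem MomentEmbedding.dual_le (e : MomentEmbedding Y E t) (ht : 1 ≤ t)
    {ιX : X → F} (hιX : Continuous ιX) {C : X → PSpace Y t → EReal} {K : ℝ}
    (hK : ∀ x p, (K : EReal) ≤ C x p) {f : F × (ProbabilityMeasure E × ℝ≥0∞) → ℝ≥0∞}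
    (hf : LowerSemicontinuous f)
    (hfc : ∀ x p, f (ιX x, e.embed p) = (C x p - K).toENNReal)
    (μ : ProbabilityMeasure X) (ν : PSpace Y t) {ψ : Y → ℝ} (hψ : ψ ∈ Phi Y t) :
    eintegral (μ : Measure X) (RC C ψ) - ((∫ y, ψ y ∂ν.toMeasure : ℝ) : EReal) ≤ V C μ ν := by
  refine le_iInf₂ fun π hπ => ?_
  obtain ⟨v, hv, hcost, hvq⟩ := e.exists_measurable_cost ht hιX hK hf hfc hπ
  obtain ⟨hint, hval⟩ := integrable_integral_condKernel ht hπ hψ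
  rw [hcost]
  have hle : eintegral (μ : Measure X) (RC C ψ) ≤ ((∫ y, ψ y ∂ν.toMeasure + K : ℝ) : EReal)
      + ((∫⁻ x, v x ∂(μ : Measure X) : ℝ≥0∞) : EReal) := by
    have h := eintegral_coe_add (μ := (μ : Measure X))
      (u := fun x => ∫ y, ψ y ∂(π : Measure (X × Y)).condKernel x + K)
      (hint.add (integrable_const K))
      ((StronglyMeasurable.integral_kernel hψ.1.stronglyMeasurable).measurable.add_const K) hv
    rw [integral_add hint (integrable_const K), hval, integral_const, probReal_univ, one_smul] at h
    rw [← h]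
    -- Monotonicity against a measurable majorant suffices, so measurability of `RC C ψ` is not
    -- needed.
    refine eintegral_mono_ae ?_
    filter_upwards [ae_exists_toMeasure_eq_condKernel ht hπ, hvq] with x hx hvx
    obtain ⟨q, hq⟩ := hx
    refine (iInf_le _ q).trans ?_
    rw [hvx q hq, EReal.coe_add, add_assoc, coe_add_toENNReal_sub (hK x q), hq]
  rw [EReal.coe_add, add_assoc] at hle
  rw [EReal.sub_le_iff_le_add (by simp) (by simp), add_comm]
  exact hle

/-- Strong duality. -/
theorem MomentEmbedding.le_dual (e : MomentEmbedding Y E t) (ht : 1 ≤ t)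
    {ιX : X → F} (hιX : IsEmbedding ιX) {C : X → PSpace Y t → EReal} {K : ℝ}
    (hK : ∀ x p, (K : EReal) ≤ C x p) (hC : ∀ x, ConvexOnPSpace (C x))
    {f : F × (ProbabilityMeasure E × ℝ≥0∞) → ℝ≥0∞} (hf : LowerSemicontinuous f)
    (hfc : ∀ x p, f (ιX x, e.embed p) = (C x p - K).toENNReal)
    (μ : ProbabilityMeasure X) (ν : PSpace Y t) :
    V C μ ν ≤ ⨆ ψ ∈ Phi Y t,
      (eintegral (μ : Measure X) (RC C ψ) - ((∫ y, ψ y ∂ν.toMeasure : ℝ) : EReal)) := by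
  refine EReal.le_of_forall_lt_iff_le.1 fun a ha => ?_
  set m : ℝ := a - K with hm
  -- Admissibility says `φ + K ≤ RC C ψ`, so the pair's value plus `K` is at most the dual value,
  -- which is below `a = m + K`.
  have hdual : ∀ (φ : BoundedContinuousFunction X ℝ), ∀ ψ ∈ Phi Y t,
      (∀ x p, (φ x : EReal) ≤ ((∫ y, ψ y ∂p.toMeasure : ℝ) : EReal)
        + ((C x p - K).toENNReal : EReal)) →
      ∫ x, φ x ∂(μ : Measure X) - ∫ y, ψ y ∂ν.toMeasure ≤ m := by
    intro φ ψ hψ h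
    have hint : Integrable φ (μ : Measure X) := φ.integrable _
    have h1 : ((∫ x, φ x ∂(μ : Measure X) + K : ℝ) : EReal) ≤ eintegral (μ : Measure X) (RC C ψ) := by
      have h2 := eintegral_coe_add (μ := (μ : Measure X)) (u := fun x => φ x + K) (v := fun _ => 0)
        (hint.add (integrable_const K)) (φ.continuous.measurable.add_const K) measurable_const
      rw [integral_add hint (integrable_const K), integral_const, probReal_univ, one_smul,
        lintegral_zero, EReal.coe_ennreal_zero, add_zero] at h2
      rw [← h2]
      refine eintegral_mono_ae (ae_of_all _ fun x => le_iInf fun p => ?_)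
      have h3 := (coe_add_le_coe_add (K := K)).2 (h x p)
      rw [add_left_comm, coe_add_toENNReal_sub (hK x p), add_comm, ← EReal.coe_add] at h3
      simpa using h3
    have h3 : ((∫ x, φ x ∂(μ : Measure X) + K : ℝ) : EReal) - ((∫ y, ψ y ∂ν.toMeasure : ℝ) : EReal)
        < a := lt_of_le_of_lt ((EReal.sub_le_sub h1 le_rfl).trans (le_iSup₂_of_le
          (f := fun ψ (_ : ψ ∈ Phi Y t) => eintegral (μ : Measure X) (RC C ψ)
            - ((∫ y, ψ y ∂ν.toMeasure : ℝ) : EReal)) ψ hψ le_rfl)) ha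
    rw [← EReal.coe_sub, EReal.coe_lt_coe_iff] at h3
    linarith
  have hm0 : 0 ≤ m := by
    have := hdual 0 0 ⟨continuous_const, 0, 0, 0, e.base, fun y => by simp⟩ fun x p => by
      simp [EReal.coe_ennreal_nonneg]
    simpa using this
  -- The `n`-th measure meets the first `n` test constraints up to `1 / (n + 1)`, so each fixed
  -- constraint holds in the limit.
  choose P hP hPF hPE hPb hPb' using fun n : ℕ => e.exists_approx ht hιX.continuous
    (fun x p => (C x p - K).toENNReal) hf hfc μ ν hm0 hdual n (ε := 1 / ((n : ℝ) + 1))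
    (by positivity)
  have hε : Tendsto (fun n : ℕ => 1 / ((n : ℝ) + 1)) atTop (𝓝 0) :=
    tendsto_one_div_add_atTop_nhds_zero_nat
  have hε' : Tendsto (fun n : ℕ => ENNReal.ofReal (1 / ((n : ℝ) + 1))) atTop (𝓝 0) := by
    have := (ENNReal.continuous_ofReal.tendsto 0).comp hε
    rwa [ENNReal.ofReal_zero] at this
  have hlim {u : ℕ → ℕ → ℝ} {l : ℕ → ℝ} (h : ∀ n, ∀ j < n, |u n j - l j| < 1 / ((n : ℝ) + 1))
      (j : ℕ) : Tendsto (fun n => u n j) atTop (𝓝 (l j)) := by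
    rw [tendsto_iff_dist_tendsto_zero]
    refine tendsto_of_tendsto_of_tendsto_of_le_of_le' tendsto_const_nhds hε
      (Eventually.of_forall fun _ => dist_nonneg) ?_
    filter_upwards [eventually_gt_atTop j] with n hn
    exact (h n j hn).le
  obtain ⟨Q, hQ, hQ1, hQ2, hQr, hQm, hQf⟩ := e.exists_limit ht hιX hf μ ν P hP (hlim hPF) (hlim hPE)
    (b := fun n => ν.moment e.base + ENNReal.ofReal (1 / ((n : ℝ) + 1)))
    (b' := fun n => ENNReal.ofReal m + ENNReal.ofReal (1 / ((n : ℝ) + 1))) (m := ENNReal.ofReal m)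
    (by simpa using hε'.const_add (ν.moment e.base))
    (by simpa using hε'.const_add (ENNReal.ofReal m)) hPb hPb'
  obtain ⟨π, hπ, κ, hκ, hκc⟩ := e.exists_coupling ht hιX hf hfc
    (fun x => (hC x).toENNReal_sub (hK x)) μ ν Q hQ1 hQ2 hQr hQm
  obtain ⟨v, hv, hcost, hvq⟩ := e.exists_measurable_cost ht hιX.continuous hK hf hfc hπ
  have hvm : ∫⁻ x, v x ∂(μ : Measure X) ≤ ENNReal.ofReal m := by
    refine le_trans (lintegral_mono_ae ?_) (hκc.trans hQf)
    filter_upwards [hκ, hvq] with x h1 h2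
    exact (h2 _ h1).le
  calc V C μ ν ≤ _ := iInf₂_le π hπ
    _ = (K : EReal) + ((∫⁻ x, v x ∂(μ : Measure X) : ℝ≥0∞) : EReal) := hcost
    _ ≤ (K : EReal) + (ENNReal.ofReal m : EReal) :=
        add_le_add le_rfl (EReal.coe_ennreal_le_coe_ennreal_iff.2 hvm)
    _ = a := by
        rw [EReal.coe_ennreal_ofReal, max_eq_left hm0, ← EReal.coe_add, hm]
        congr 1
        ring

end Main

end WeakTransport

theorem theorem1p3
    {X Y : Type*}
    [TopologicalSpace X] [PolishSpace X] [MeasurableSpace X] [BorelSpace X]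
    [MetricSpace Y] [PolishSpace Y] [MeasurableSpace Y] [BorelSpace Y] [Nonempty Y]
    (t : ℝ) (ht : 1 ≤ t)
    (C : X → WeakTransport.PSpace Y t → EReal)
    (hC_lsc : LowerSemicontinuous (fun z : X × WeakTransport.PSpace Y t => C z.1 z.2))
    (hC_bdd : ∃ K : ℝ, ∀ x p, (K : EReal) ≤ C x p)
    (hC_conv : ∀ x, WeakTransport.ConvexOnPSpace (C x))
    (μ : ProbabilityMeasure X) (ν : WeakTransport.PSpace Y t) :
    WeakTransport.V C μ ν =
      ⨆ ψ ∈ WeakTransport.Phi Y t,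
        (WeakTransport.eintegral (μ : Measure X) (WeakTransport.RC C ψ)
          - ((∫ y, ψ y ∂ν.toMeasure : ℝ) : EReal)) := by
  obtain ⟨K, hK⟩ := hC_bdd
  have : Nonempty X := μ.nonempty
  obtain ⟨ιX, hιX⟩ := WeakTransport.exists_isEmbedding_hilbertCube X
  obtain ⟨e⟩ := WeakTransport.nonempty_momentEmbedding Y t
  let := TopologicalSpace.metrizableSpaceMetric (ℕ → unitInterval)
  let := TopologicalSpace.metrizableSpaceMetric (ℝ≥0∞ × (ℕ → unitInterval))
  obtain ⟨f, hf, hfc⟩ := e.exists_extension ht hιX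
    (fun z : X × WeakTransport.PSpace Y t => (C z.1 z.2 - K).toENNReal)
    (WeakTransport.lowerSemicontinuous_toENNReal_sub hC_lsc fun z => hK z.1 z.2)
  refine le_antisymm (e.le_dual ht hιX hK hC_conv hf hfc μ ν) (iSup₂_le fun ψ hψ => ?_)
  exact e.dual_le ht hιX.continuous hK hf hfc μ ν hψ
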